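/- Let $k\ge 1$ and $n=2k-1$. A model $(\pi,\mathbf m)$ consists of a probability vector $\pi\in\Delta^{k-1}$ and a matrix $\mathbf m\in[0,1]^{n\times k}$. For $\zeta,\pi_{\min}>0$, let $\mathcal D_{n,\zeta,\pi_{\min}}$ be the set of models with $\pi_j\ge\pi_{\min}$ for all $j$ and $|\mathbf m_{ij}-\mathbf m_{ij'}|\ge\zeta$ for all $i$ and all $j\ne j'$. For two models put $$d_{\mathrm{model}}((\pi,\mathbf m),(\pi',\mathbf m'))=\min_{\rho\in S_k}\max\Big\{\max_j|\pi_j-\pi'_{\rho(j)}|,\ \max_{i,j}|\mathbf m_{ij}-\mathbf m'_{i\rho(j)}|\Big\}.$$ Random variables $X_1,\dots,X_n$ with values in $[0,1]$ are said to follow the model $(\pi,\mathbf m)$ if they are independent conditional on a latent random variable $U$ with values in $\{1,\dots,k\}$, where $\Pr(U=j)=\pi_j$ and $\mathbb E(X_i\mid U=j)=\mathbf m_{ij}$; equivalently, their joint law is $\sum_j\pi_j\bigotimes_i\nu_{ij}$ for probability measures $\nu_{ij}$ on $[0,1]$ with mean $\mathbf m_{ij}$. There are a constant $C\in\mathbb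 N$ and an algorithm (a computable function) $\mathcal A$ with the following property. Let $k\ge1$, $n=2k-1$, $0<\zeta\le1$, $\pi_{\min}>0$, $\varepsilon>0$ and $0<\delta\le\frac12$, let $(\pi,\mathbf m)\in\mathcal D_{n,\zeta,\pi_{\min}}$, let $(X_1,\dots,X_n)$ follow $(\pi,\mathbf m)$, and let $$N\ \ge\ C\,(1/\zeta)^{Ck}\,(1/\pi_{\min})^{C}\,(1/\varepsilon)^2\,\log(1/\delta)$$ be an integer. Given only $k$ and $N$ independent samples of $(X_1,\dots,X_n)$, with every observed number $x$ read to $N$ binary digits as $\lfloor 2^Nx\rfloor$ (which loses nothing for binary variables), $\mathcal A$ outputs parameters $(\tilde\pi,\tilde{\mathbf m})$ with rational entries such that, with probability at least $1-\delta$, $(\tilde\pi,\tilde{\mathbf m})$ is a model and $$d_{\mathrm{model}}((\pi,\mathbf m),(\tilde\pi,\tilde{\mathbf m}))<\varepsilon .$$ In particular, for any constant failure probability, and even for failure probability $2^{-k}$, $(1/\zeta)^{O(k)}(1/\pi_{\min})^{O(1)}(1/\varepsilon)^2$ samples suffice to compute a model within $\varepsilon$ of the truth in $d_{\mathrm{model}}$.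 -/

import Mathlib

namespace MixProd

/-- Parameters `(π, m)` of a mixture of `k` product distributions on `n` observables:
`π j` is the weight of the `j`-th component and `m i j` is the mean of the `i`-th observable
conditional on the `j`-th component. -/
abbrev Params (n k : ℕ) : Type := (Fin k → ℝ) × (Fin n → Fin k → ℝ)

/-- The models: the weights form a probability vector and all means lie in `[0,1]`. -/
def models (n k : ℕ) : Set (Params n k) :=
  {θ | θ.1 ∈ stdSimplex ℝ (Fin k) ∧ ∀ i j, θ.2 i j ∈ Set.Icc (0 : ℝ) 1}

/-- The models all of whose weights are at least `πmin` and all of whose observables are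
`ζ`-separated. -/
def separatedModels (n k : ℕ) (ζ πmin : ℝ) : Set (Params n k) :=
  {θ | θ ∈ models n k ∧ (∀ j, πmin ≤ θ.1 j) ∧
    ∀ i j j', j ≠ j' → ζ ≤ |θ.2 i j - θ.2 i j'|}

/-- The `L_∞` distance of two models up to relabelling of the components. -/
noncomputable def modelDist {n k : ℕ} (θ θ' : Params n k) : ℝ :=
  ⨅ ρ : Equiv.Perm (Fin k),
    max (⨆ j, |θ.1 j - θ'.1 (ρ j)|) (⨆ i, ⨆ j, |θ.2 i j - θ'.2 i (ρ j)|)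

/-- `P` is the joint law of `n` random variables with values in `[0,1]` that are independent
conditional on a latent variable `U` with values in `Fin k`, where `U = j` has probability
`θ.1 j` and the `i`-th variable has conditional mean `θ.2 i j` given `U = j`.
Here `ν i j` is the conditional law of the `i`-th variable given `U = j`. -/
def IsMixtureLaw {n k : ℕ} (θ : Params n k) (P : MeasureTheory.Measure (Fin n → ℝ)) : Prop :=
  ∃ ν : Fin n → Fin k → MeasureTheory.Measure ℝ,
    (∀ i j, MeasureTheory.IsProbabilityMeasure (ν i j)) ∧
    (∀ i j, ∀ᵐ x ∂(ν i j), x ∈ Set.Icc (0 : ℝ) 1) ∧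
    (∀ i j, ∫ x, x ∂(ν i j) = θ.2 i j) ∧
    P = ∑ j, ENNReal.ofReal (θ.1 j) • MeasureTheory.Measure.pi (fun i => ν i j)

/-- The joint law of `N` independent samples from `P`. -/
noncomputable def sampleLaw {n : ℕ} (N : ℕ) (P : MeasureTheory.Measure (Fin n → ℝ)) :
    MeasureTheory.Measure (Fin N → Fin n → ℝ) :=
  MeasureTheory.Measure.pi (fun _ => P)

/-- What a machine reads of a list of `N` samples: every observed number `x` is read to `N`
binary digits after the point, as the integer `⌊2 ^ N * x⌋`. (Binary data are read exactly:
`0` as `0` and `1` as `2 ^ N`.) -/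
noncomputable def digitize {n N : ℕ} (X : Fin N → Fin n → ℝ) : List (List ℕ) :=
  List.ofFn fun s => List.ofFn fun i => ⌊2 ^ N * X s i⌋₊

/-- The parameters with rational entries that are written as a common denominator `c.1`, the list
`c.2.1` of the numerators of the weights, and the list `c.2.2` of the rows of numerators of the
means (missing list entries are read as zero). -/
noncomputable def readParams (n k : ℕ) (c : ℕ × List ℕ × List (List ℕ)) : Params n k :=
  (fun j => (c.2.1.getD j 0 : ℝ) / c.1, fun i j => ((c.2.2.getD i []).getD j 0 : ℝ) / c.1)

end MixProd

/-!
The proof is by the method of moments. For a group of `k - 1` observables, Lagrange interpolation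
gives, for every component `j` of the true model, a product of affine functions of these observables
whose conditional mean is `1` given `j` and `0` given any other component. Let `F` and `G` hold the
conditional means of such test polynomials, for two disjoint groups, under the components of a
second model, and let `X`, `X'` be the means of the remaining observable and `D`, `D'` the weights
of the two models. If all `2 ^ n` multilinear moments of the two models nearly agree, then
`F D' Gᵀ ≈ D` and `F D' X' Gᵀ ≈ D X`. The first relation makes `F D'` well conditioned, and so
`(X' l - X j) * G j l ≈ 0` for all `j` and `l`. As the `X j` are separated, this matches the
components of the two models, and then the expectations of the test polynomials, alone and times
one more observable, recover the weights and the means. Hence the parameters are a Lipschitz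
function of the moments near a separated model.

The estimator searches the grid of models with denominator `2 ^ N` for one whose moments are closest
to the empirical ones. By Hoeffding's inequality and a union bound over the `2 ^ n` moments, the
latter are close to the true ones.
-/

namespace MixProd

open Finset
open scoped Matrix

section LinearAlgebra

open scoped Matrix.Norms.Operator

variable {κ : Type*} [Fintype κ] [DecidableEq κ]

lemma norm_le_two_mul_norm_mulVec {M : Matrix κ κ ℝ} (hM : ‖M - 1‖ ≤ 1 / 2) (y : κ → ℝ) :
    ‖y‖ ≤ 2 * ‖M *ᵥ y‖ := by
  have hsplit : y = M *ᵥ y - (M - 1) *ᵥ y := by simp [Matrix.sub_mulVec]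
  have hpert : ‖(M - 1) *ᵥ y‖ ≤ 1 / 2 * ‖y‖ :=
    (Matrix.linfty_opNorm_mulVec _ _).trans (by gcongr)
  have : ‖y‖ ≤ ‖M *ᵥ y‖ + ‖(M - 1) *ᵥ y‖ := by
    conv_lhs => rw [hsplit]
    exact norm_sub_le _ _
  linarith

lemma norm_le_of_norm_mul_sub_one_le {A B : Matrix κ κ ℝ} (h : ‖A * B - 1‖ ≤ 1 / 2)
    (v : κ → ℝ) : ‖v‖ ≤ 2 * ‖B‖ * ‖A *ᵥ v‖ := by
  have hinj : Function.Injective B.mulVec := fun x y hxy ↦ by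
    have := norm_le_two_mul_norm_mulVec h (x - y)
    rw [← Matrix.mulVec_mulVec, Matrix.mulVec_sub, hxy, sub_self, Matrix.mulVec_zero, norm_zero,
      mul_zero] at this
    exact sub_eq_zero.1 (norm_le_zero_iff.1 this)
  -- `B` is square, so every vector is of the form `B *ᵥ y`.
  obtain ⟨y, rfl⟩ := Matrix.mulVec_surjective_iff_isUnit.2
    (Matrix.mulVec_injective_iff_isUnit.1 hinj) v
  calc ‖B *ᵥ y‖ ≤ ‖B‖ * ‖y‖ := Matrix.linfty_opNorm_mulVec B y
    _ ≤ ‖B‖ * (2 * ‖(A * B) *ᵥ y‖) := by gcongr; exact norm_le_two_mul_norm_mulVec h y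
    _ = 2 * ‖B‖ * ‖A *ᵥ B *ᵥ y‖ := by rw [Matrix.mulVec_mulVec]; ring

lemma norm_le_card_mul {M : Matrix κ κ ℝ} {b : ℝ} (hb : 0 ≤ b) (h : ∀ i j, |M i j| ≤ b) :
    ‖M‖ ≤ Fintype.card κ * b := by
  lift b to NNReal using hb
  rw [Matrix.linfty_opNorm_def, ← NNReal.coe_natCast, ← NNReal.coe_mul, NNReal.coe_le_coe]
  refine Finset.sup_le fun i _ ↦ ?_
  rw [← Finset.card_univ, ← nsmul_eq_mul]
  exact sum_le_card_nsmul _ _ _ fun j _ ↦ h i j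

end LinearAlgebra

section TestPolynomials

variable {ι ι' κ κ' : Type*} [Fintype κ'] [Fintype κ]

/-- The expectation of `∏ i ∈ S, X i` under the mixture of products with weights `w` and
means `m`. -/
def moment (w : κ → ℝ) (m : ι → κ → ℝ) (S : Finset ι) : ℝ := ∑ l, w l * ∏ i ∈ S, m i l

/-- All multilinear moments of two mixtures of products differ by at most `η`. -/
def MomentsClose (η : ℝ) (w : κ → ℝ) (w' : κ' → ℝ) (m : ι → κ → ℝ)
    (m' : ι → κ' → ℝ) : Prop :=
  ∀ S : Finset ι, |moment w m S - moment w' m' S| ≤ η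

lemma moment_comp {e : ι' → ι} (he : Function.Injective e) (w : κ → ℝ) (m : ι → κ → ℝ)
    (S : Finset ι') : moment w (fun i ↦ m (e i)) S = moment w m (S.map ⟨e, he⟩) := by
  simp [moment]

variable {η : ℝ} {w : κ → ℝ} {w' : κ' → ℝ} {m : ι → κ → ℝ} {m' : ι → κ' → ℝ}

lemma MomentsClose.comp (h : MomentsClose η w w' m m') {e : ι' → ι} (he : Function.Injective e) :
    MomentsClose η w w' (fun i ↦ m (e i)) fun i ↦ m' (e i) := fun S ↦ by
  rw [moment_comp he, moment_comp he]
  exact h _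

lemma MomentsClose.nonneg (h : MomentsClose η w w' m m') : 0 ≤ η :=
  (abs_nonneg _).trans (h ∅)

variable [Fintype ι'] [Fintype ι]

/-- A product `∏ i, (slope i * X i + const i)` of one affine function of each observable. -/
structure AffineProd (ι : Type*) where
  /-- the slopes of the factors -/
  slope : ι → ℝ
  /-- the constant terms of the factors -/
  const : ι → ℝ

namespace AffineProd

/-- The value of a product of affine functions at a point. -/
def eval (f : AffineProd ι) (x : ι → ℝ) : ℝ := ∏ i, (f.slope i * x i + f.const i)

/-- The sum of the absolute values of the coefficients of a product of affine functions. -/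
def coeffNorm (f : AffineProd ι) : ℝ := ∏ i, (|f.slope i| + |f.const i|)

/-- The expectation of a product of affine functions under the mixture of products with weights
`w` and means `m`. -/
def expect (f : AffineProd ι) (w : κ → ℝ) (m : ι → κ → ℝ) : ℝ :=
  ∑ l, w l * f.eval fun i ↦ m i l

/-- The product of two products of affine functions of disjoint sets of observables. -/
def sumElim (f : AffineProd ι) (g : AffineProd ι') : AffineProd (ι ⊕ ι') where
  slope := Sum.elim f.slope g.slope
  const := Sum.elim f.const g.const

/-- An affine function of a single observable. -/
def single (a b : ℝ) : AffineProd Unit := ⟨fun _ ↦ a, fun _ ↦ b⟩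

lemma eval_sumElim (f : AffineProd ι) (g : AffineProd ι') (x : ι ⊕ ι' → ℝ) :
    (f.sumElim g).eval x = f.eval (fun i ↦ x (.inl i)) * g.eval fun i ↦ x (.inr i) := by
  simp [eval, sumElim, Fintype.prod_sum_type]

lemma coeffNorm_sumElim (f : AffineProd ι) (g : AffineProd ι') :
    (f.sumElim g).coeffNorm = f.coeffNorm * g.coeffNorm := by
  simp [coeffNorm, sumElim, Fintype.prod_sum_type]

lemma eval_single (a b : ℝ) (x : Unit → ℝ) : (single a b).eval x = a * x () + b := by
  simp [eval, single]

lemma coeffNorm_single (a b : ℝ) : (single a b).coeffNorm = |a| + |b| := by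
  simp [coeffNorm, single]

lemma coeffNorm_nonneg (f : AffineProd ι) : 0 ≤ f.coeffNorm :=
  prod_nonneg fun _ _ ↦ by positivity

lemma abs_eval_le_coeffNorm (f : AffineProd ι) {x : ι → ℝ} (hx : ∀ i, x i ∈ Set.Icc (0 : ℝ) 1) :
    |f.eval x| ≤ f.coeffNorm := by
  rw [eval, abs_prod]
  refine prod_le_prod (fun i _ ↦ abs_nonneg _) fun i _ ↦ (abs_add_le _ _).trans ?_
  rw [abs_mul, abs_of_nonneg (hx i).1]
  gcongr
  exact mul_le_of_le_one_right (abs_nonneg _) (hx i).2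

end AffineProd

lemma AffineProd.expect_eq_sum_moment [DecidableEq ι] (f : AffineProd ι) (w : κ → ℝ)
    (m : ι → κ → ℝ) :
    f.expect w m =
      ∑ S : Finset ι, (∏ i ∈ S, f.slope i) * (∏ i ∈ univ \ S, f.const i) * moment w m S := by
  simp only [expect, eval, moment, prod_add, powerset_univ, mul_sum]
  rw [sum_comm]
  refine sum_congr rfl fun S _ ↦ sum_congr rfl fun l _ ↦ ?_
  rw [prod_mul_distrib]
  ring

lemma MomentsClose.abs_expect_sub_le (h : MomentsClose η w w' m m') (f : AffineProd ι) :
    |f.expect w' m' - f.expect w m| ≤ η * f.coeffNorm := by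
  classical
  rw [abs_sub_comm, f.expect_eq_sum_moment, f.expect_eq_sum_moment, ← sum_sub_distrib,
    AffineProd.coeffNorm, prod_add, powerset_univ, mul_sum]
  refine (abs_sum_le_sum_abs _ _).trans (sum_le_sum fun S _ ↦ ?_)
  rw [← mul_sub, abs_mul, abs_mul, abs_prod, abs_prod, mul_comm]
  gcongr
  exact h S

end TestPolynomials

section Lagrange

variable {t : ℕ}

/-- The multilinear Lagrange polynomial of the component `j`: it takes the value `1` at the `j`-th
column of `m` and vanishes at the others, because each of its `t` affine factors kills one of the
`t` other columns. -/
noncomputable def lagrange (m : Fin t → Fin (t + 1) → ℝ) (j : Fin (t + 1)) :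
    AffineProd (Fin t) where
  slope i := (m i j - m i (j.succAbove i))⁻¹
  const i := -m i (j.succAbove i) * (m i j - m i (j.succAbove i))⁻¹

variable {m : Fin t → Fin (t + 1) → ℝ} {ζ : ℝ}

lemma lagrange_eval_column (hm : ∀ i, Function.Injective (m i)) (j l : Fin (t + 1)) :
    ((lagrange m j).eval fun i ↦ m i l) = if l = j then 1 else 0 := by
  split_ifs with h
  · subst h
    refine prod_eq_one fun i _ ↦ ?_
    have : m i l - m i (l.succAbove i) ≠ 0 :=
      sub_ne_zero.2 ((hm i).ne (Fin.succAbove_ne l i).symm)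
    simp only [lagrange]
    field_simp
    ring
  · obtain ⟨i, rfl⟩ := Fin.exists_succAbove_eq h
    refine prod_eq_zero (mem_univ i) ?_
    simp only [lagrange]
    ring

lemma injective_of_separated {κ : Type*} {x : κ → ℝ} (hζ : 0 < ζ)
    (hx : ∀ j j', j ≠ j' → ζ ≤ |x j - x j'|) : Function.Injective x := fun j j' h ↦ by
  by_contra hne
  have := hx j j' hne
  rw [h, sub_self, abs_zero] at this
  linarith

lemma coeffNorm_lagrange_le (hζ : 0 < ζ) (hm : ∀ i j j', j ≠ j' → ζ ≤ |m i j - m i j'|)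
    (h01 : ∀ i j, m i j ∈ Set.Icc (0 : ℝ) 1) (j : Fin (t + 1)) :
    (lagrange m j).coeffNorm ≤ (2 / ζ) ^ t := by
  suffices h : ∀ i, |(lagrange m j).slope i| + |(lagrange m j).const i| ≤ 2 / ζ by
    simpa [AffineProd.coeffNorm, div_pow] using
      prod_le_prod (s := univ) (fun i _ ↦ by positivity) fun i _ ↦ h i
  intro i
  have hslope : |(lagrange m j).slope i| ≤ 1 / ζ := by
    simp only [lagrange]
    rw [abs_inv, one_div]
    exact inv_anti₀ hζ (hm i j _ (Fin.succAbove_ne j i).symm)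
  have hconst : |(lagrange m j).const i| ≤ |(lagrange m j).slope i| := by
    simp only [lagrange]
    rw [abs_mul, abs_neg, abs_of_nonneg (h01 _ _).1]
    exact mul_le_of_le_one_left (abs_nonneg _) (h01 _ _).2
  calc _ ≤ 1 / ζ + 1 / ζ := add_le_add hslope (hconst.trans hslope)
    _ = 2 / ζ := by ring

/-- The values of the Lagrange polynomials of `m` at the columns of `m'`. -/
noncomputable def lagrangeMatrix (m m' : Fin t → Fin (t + 1) → ℝ) :
    Matrix (Fin (t + 1)) (Fin (t + 1)) ℝ :=
  Matrix.of fun j l ↦ (lagrange m j).eval fun i ↦ m' i l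

lemma lagrangeMatrix_self (hm : ∀ i, Function.Injective (m i)) : lagrangeMatrix m m = 1 := by
  ext j l
  rw [lagrangeMatrix, Matrix.of_apply, lagrange_eval_column hm, Matrix.one_apply]
  simp only [eq_comm]

lemma abs_lagrangeMatrix_le (hζ : 0 < ζ) (hm : ∀ i j j', j ≠ j' → ζ ≤ |m i j - m i j'|)
    (h01 : ∀ i j, m i j ∈ Set.Icc (0 : ℝ) 1) {m' : Fin t → Fin (t + 1) → ℝ}
    (h01' : ∀ i j, m' i j ∈ Set.Icc (0 : ℝ) 1) (j l : Fin (t + 1)) :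
    |lagrangeMatrix m m' j l| ≤ (2 / ζ) ^ t :=
  ((lagrange m j).abs_eval_le_coeffNorm fun i ↦ h01' i l).trans (coeffNorm_lagrange_le hζ hm h01 j)

end Lagrange

section Alignment

variable {κ : Type*} [Fintype κ]

lemma mul_diagonal_mul_transpose_apply [DecidableEq κ] (F G : Matrix κ κ ℝ) (d : κ → ℝ)
    (i j : κ) : (F * Matrix.diagonal d * Gᵀ) i j = ∑ l, d l * (F i l * G j l) := by
  refine (Matrix.mul_apply ..).trans (sum_congr rfl fun l _ ↦ ?_)
  rw [Matrix.mul_diagonal, Matrix.transpose_apply]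
  ring

/-- If all `|g l|` were below `p / (2 * L)`, the average of `f * g` would be below `p / 2`. -/
lemma exists_half_le {f g w : κ → ℝ} {L p : ℝ} (hL : 0 < L) (hp : 0 < p) (hw : ∀ l, 0 ≤ w l)
    (hsum : ∑ l, w l = 1) (hf : ∀ l, |f l| ≤ L) (h : p / 2 ≤ ∑ l, w l * (f l * g l)) :
    ∃ l, p / (2 * L) ≤ |g l| := by
  by_contra! hcon
  have hterm : ∀ l, f l * g l < p / 2 := fun l ↦ by
    calc f l * g l ≤ |f l| * |g l| := (le_abs_self _).trans (abs_mul _ _).le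
      _ ≤ L * |g l| := by gcongr; exact hf l
      _ < L * (p / (2 * L)) := by gcongr; exact hcon l
      _ = p / 2 := by field_simp
  obtain ⟨l₀, -, hl₀⟩ : ∃ l ∈ univ, 0 < w l :=
    exists_lt_of_sum_lt (f := fun _ ↦ (0 : ℝ)) (by simp [hsum])
  have : ∑ l, w l * (f l * g l) < ∑ l, w l * (p / 2) :=
    sum_lt_sum (fun l _ ↦ mul_le_mul_of_nonneg_left (hterm l).le (hw l))
      ⟨l₀, mem_univ _, mul_lt_mul_of_pos_left (hterm l₀) hl₀⟩
  rw [← sum_mul, hsum] at this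
  linarith

lemma exists_perm_abs_sub_le {κ : Type*} [Finite κ] {x x' : κ → ℝ} {ζ : ℝ} {r : κ → κ}
    (hx : ∀ j j', j ≠ j' → ζ ≤ |x j - x j'|) (hr : ∀ j, |x' (r j) - x j| ≤ ζ / 4) (hζ : 0 < ζ) :
    ∃ ρ : Equiv.Perm κ, ∀ j l, l ≠ ρ j → ζ / 2 ≤ |x' l - x j| := by
  have hfar : ∀ j j', j ≠ j' → ζ / 2 < |x' (r j') - x j| := fun j j' hne ↦ by
    have := abs_sub_le (x j) (x' (r j')) (x j')
    rw [abs_sub_comm (x j) (x' (r j'))] at this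
    linarith [hx j j' hne, hr j']
  have hinj : Function.Injective r := fun j j' hjj ↦ by
    by_contra hne
    have := hfar j j' hne
    rw [← hjj] at this
    linarith [hr j]
  have hbij := Finite.injective_iff_bijective.1 hinj
  refine ⟨Equiv.ofBijective r hbij, fun j l hl ↦ ?_⟩
  obtain ⟨j', rfl⟩ := hbij.2 l
  exact (hfar j j' fun h ↦ hl (h ▸ rfl)).le

/-- Up to an entrywise error `e`, the matrices `F` and `G` turn `diagonal d'` into `diagonal d`.
The rows of `F` and `G` are the values of test polynomials at the columns of the second model. -/
def ApproxDiagonalizes [DecidableEq κ] (e : ℝ) (F G : Matrix κ κ ℝ) (d d' : κ → ℝ) : Prop :=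
  ∀ i j, |(F * Matrix.diagonal d' * Gᵀ - Matrix.diagonal d) i j| ≤ e

section

variable [DecidableEq κ] {F G : Matrix κ κ ℝ} {w w' x x' : κ → ℝ} {e p L : ℝ}

lemma ApproxDiagonalizes.symm {d d' : κ → ℝ} (h : ApproxDiagonalizes e F G d d') :
    ApproxDiagonalizes e G F d d' := fun i j ↦ by
  have htrans : G * Matrix.diagonal d' * Fᵀ - Matrix.diagonal d =
      (F * Matrix.diagonal d' * Gᵀ - Matrix.diagonal d)ᵀ := by
    simp [Matrix.transpose_mul, Matrix.mul_assoc]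
  rw [htrans]
  exact h j i

lemma ApproxDiagonalizes.abs_sum_sub_le {d d' : κ → ℝ} (h : ApproxDiagonalizes e F G d d')
    (j : κ) : |∑ l, d' l * (F j l * G j l) - d j| ≤ e := by
  simpa [Matrix.sub_apply, mul_diagonal_mul_transpose_apply] using h j j

lemma ApproxDiagonalizes.abs_mulVec_le (h : ApproxDiagonalizes e F G w w')
    (hX : ApproxDiagonalizes e F G (w * x) (w' * x')) {j : κ} (hx : |x j| ≤ 1) (i : κ) :
    |((F * Matrix.diagonal w') *ᵥ fun l ↦ (x' l - x j) * G j l) i| ≤ 2 * e := by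
  have hdiag : Matrix.diagonal (w * x) i j = x j * Matrix.diagonal w i j := by
    rcases eq_or_ne i j with rfl | hij
    · simp [mul_comm]
    · simp [hij]
  have hentry : ((F * Matrix.diagonal w') *ᵥ fun l ↦ (x' l - x j) * G j l) i =
      (F * Matrix.diagonal (w' * x') * Gᵀ - Matrix.diagonal (w * x)) i j -
        x j * (F * Matrix.diagonal w' * Gᵀ - Matrix.diagonal w) i j := by
    simp only [Matrix.sub_apply, mul_diagonal_mul_transpose_apply, hdiag, mul_sub, mul_sum,
      sub_sub_sub_cancel_right, ← sum_sub_distrib, Matrix.mulVec, dotProduct,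
      Matrix.mul_diagonal, Pi.mul_apply]
    exact sum_congr rfl fun l _ ↦ by ring
  rw [hentry, two_mul]
  refine (abs_sub _ _).trans (add_le_add (hX i j) ?_)
  rw [abs_mul]
  exact (mul_le_of_le_one_left (abs_nonneg _) hx).trans (h i j)

/-- `F * D'` has the approximate right inverse `Gᵀ * D⁻¹`. -/
lemma ApproxDiagonalizes.abs_sub_mul_abs_le (hL : 0 ≤ L) (hp : 0 < p) (hw : ∀ j, p ≤ w j)
    (hx : ∀ j, |x j| ≤ 1) (hG : ∀ j l, |G j l| ≤ L) (h : ApproxDiagonalizes e F G w w')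
    (hX : ApproxDiagonalizes e F G (w * x) (w' * x')) (he : Fintype.card κ * (e / p) ≤ 1 / 2)
    (j l : κ) : |x' l - x j| * |G j l| ≤ 4 * Fintype.card κ * L * e / p := by
  have he0 : 0 ≤ e := (abs_nonneg _).trans (h j j)
  have hw0 : ∀ j, 0 < w j := fun j ↦ hp.trans_le (hw j)
  set A := F * Matrix.diagonal w'
  set B := Gᵀ * Matrix.diagonal w⁻¹
  set v : κ → ℝ := fun l ↦ (x' l - x j) * G j l
  open scoped Matrix.Norms.Operator in
  have hAB : ‖A * B - 1‖ ≤ 1 / 2 := by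
    refine (norm_le_card_mul (by positivity) fun a b ↦ ?_).trans he
    have hentry : (A * B - 1) a b = (A * Gᵀ - Matrix.diagonal w) a b / w b := by
      rcases eq_or_ne a b with rfl | hab
      · simp [A, B, ← Matrix.mul_assoc, div_eq_mul_inv, sub_mul, (hw0 a).ne']
      · simp [A, B, ← Matrix.mul_assoc, div_eq_mul_inv, hab]
    rw [hentry, abs_div, abs_of_pos (hw0 b)]
    exact div_le_div₀ he0 (h a b) hp (hw b)
  open scoped Matrix.Norms.Operator in
  have hB : ‖B‖ ≤ Fintype.card κ * (L / p) :=
    norm_le_card_mul (by positivity) fun a b ↦ by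
      rw [show B a b = _ from Matrix.mul_diagonal _ _ a b, Matrix.transpose_apply, Pi.inv_apply,
        ← div_eq_mul_inv, abs_div, abs_of_pos (hw0 b)]
      exact div_le_div₀ hL (hG b a) hp (hw b)
  have hAv : ‖A *ᵥ v‖ ≤ 2 * e :=
    (pi_norm_le_iff_of_nonneg (by positivity)).2 (h.abs_mulVec_le hX (hx j))
  calc |x' l - x j| * |G j l| = ‖v l‖ := (abs_mul _ _).symm
    _ ≤ ‖v‖ := norm_le_pi_norm v l
    _ ≤ 2 * ‖B‖ * ‖A *ᵥ v‖ := norm_le_of_norm_mul_sub_one_le hAB v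
    _ ≤ 2 * (Fintype.card κ * (L / p)) * (2 * e) := by gcongr
    _ = 4 * Fintype.card κ * L * e / p := by ring

theorem ApproxDiagonalizes.exists_perm_abs_le [Nonempty κ] {ζ : ℝ} (hζ : 0 < ζ) (hL : 0 < L)
    (hp : 0 < p) (hw : ∀ j, p ≤ w j) (hw' : ∀ l, 0 ≤ w' l) (hsum : ∑ l, w' l = 1)
    (hx : ∀ j, |x j| ≤ 1) (hxζ : ∀ j j', j ≠ j' → ζ ≤ |x j - x j'|)
    (hF : ∀ j l, |F j l| ≤ L) (hG : ∀ j l, |G j l| ≤ L) (h : ApproxDiagonalizes e F G w w')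
    (hX : ApproxDiagonalizes e F G (w * x) (w' * x')) (he : Fintype.card κ * (e / p) ≤ 1 / 2)
    (hLe : 8 * Fintype.card κ * L ^ 2 * e / p ^ 2 ≤ ζ / 4) :
    ∃ ρ : Equiv.Perm κ, ∀ j l, l ≠ ρ j →
      |F j l| ≤ 8 * Fintype.card κ * L * e / (p * ζ) ∧
      |G j l| ≤ 8 * Fintype.card κ * L * e / (p * ζ) := by
  have hFτ := h.symm.abs_sub_mul_abs_le hL.le hp hw hx hF hX.symm he
  have hGτ := h.abs_sub_mul_abs_le hL.le hp hw hx hG hX he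
  have hdiag : ∀ j, p / 2 ≤ ∑ l, w' l * (F j l * G j l) := fun j ↦ by
    have hcard : 1 ≤ (Fintype.card κ : ℝ) := by exact_mod_cast Fintype.card_pos
    have he0 : 0 ≤ e / p := div_nonneg ((abs_nonneg _).trans (h j j)) hp.le
    have hep : e / p ≤ 1 / 2 := (le_mul_of_one_le_left he0 hcard).trans he
    rw [div_le_iff₀ hp] at hep
    linarith [(abs_le.1 (h.abs_sum_sub_le j)).1, hw j]
  choose r hr using fun j ↦ exists_half_le hL hp hw' hsum (hF j) (hdiag j)
  have hclose : ∀ j, |x' (r j) - x j| ≤ ζ / 4 := fun j ↦ by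
    refine le_trans ?_ hLe
    have := (mul_le_mul_of_nonneg_left (hr j) (abs_nonneg _)).trans (hGτ j (r j))
    rw [mul_div_assoc', div_le_div_iff₀ (by positivity) hp] at this
    rw [le_div_iff₀ (by positivity)]
    linarith
  obtain ⟨ρ, hρ⟩ := exists_perm_abs_sub_le hxζ hclose hζ
  have hsmall : ∀ j l y, l ≠ ρ j →
      |x' l - x j| * |y| ≤ 4 * Fintype.card κ * L * e / p →
      |y| ≤ 8 * Fintype.card κ * L * e / (p * ζ) := fun j l y hl hy ↦ by
    have := (mul_le_mul_of_nonneg_right (hρ j l hl) (abs_nonneg y)).trans hy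
    rw [le_div_iff₀ hp] at this
    rw [le_div_iff₀ (by positivity)]
    linarith
  exact ⟨ρ, fun j l hl ↦ ⟨hsmall j l _ hl (hFτ j l), hsmall j l _ hl (hGτ j l)⟩⟩

end

lemma abs_weight_mul_sub_le {g w : κ → ℝ} {r : κ} {a e c : ℝ} (hw : ∀ l, 0 ≤ w l)
    (hsum : ∑ l, w l = 1) (hc : 0 ≤ c) (hg : ∀ l, l ≠ r → |g l| ≤ c)
    (h : |∑ l, w l * g l - a| ≤ e) : |w r * g r - a| ≤ e + c := by
  classical
  have hrest : |∑ l ∈ univ.erase r, w l * g l| ≤ c := by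
    calc |∑ l ∈ univ.erase r, w l * g l| ≤ ∑ l ∈ univ.erase r, w l * c := by
          refine (abs_sum_le_sum_abs _ _).trans (sum_le_sum fun l hl ↦ ?_)
          rw [abs_mul, abs_of_nonneg (hw l)]
          exact mul_le_mul_of_nonneg_left (hg l (ne_of_mem_erase hl)) (hw l)
      _ ≤ ∑ l, w l * c := sum_le_sum_of_subset_of_nonneg (subset_univ _)
          fun l _ _ ↦ mul_nonneg (hw l) hc
      _ = c := by rw [← sum_mul, hsum, one_mul]
  have hsplit := add_sum_erase univ (fun l ↦ w l * g l) (mem_univ r)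
  rw [abs_le] at *
  constructor <;> linarith

/-- Compare the averages of `g` and `g * y`: both are carried by the atom `r`, where `w * g` is at
least `p / 2`. -/
lemma abs_observable_sub_le {g w y : κ → ℝ} {r : κ} {a b p e c D : ℝ} (hp : 0 < p) (ha : p ≤ a)
    (hw : ∀ l, 0 ≤ w l) (hsum : ∑ l, w l = 1) (hc : 0 ≤ c) (hb : |b| ≤ 1)
    (hy : ∀ l, |y l - b| ≤ D) (hg : ∀ l, l ≠ r → |g l| ≤ c) (h : |∑ l, w l * g l - a| ≤ e)
    (h' : |∑ l, w l * (g l * y l) - a * b| ≤ e) (hsmall : e + c ≤ p / 2) :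
    |y r - b| ≤ 2 * (2 * e + c * D) / p := by
  have hD : 0 ≤ D := (abs_nonneg _).trans (hy r)
  have hcentered : |∑ l, w l * (g l * (y l - b)) - 0| ≤ 2 * e := by
    have hexpand : ∑ l, w l * (g l * (y l - b)) - 0 =
        (∑ l, w l * (g l * y l) - a * b) - b * (∑ l, w l * g l - a) := by
      rw [mul_sub, mul_sum, sub_zero, mul_comm b a, sub_sub_sub_cancel_right, ← sum_sub_distrib]
      exact sum_congr rfl fun l _ ↦ by ring
    rw [hexpand, two_mul]
    refine (abs_sub _ _).trans (add_le_add h' ?_)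
    rw [abs_mul]
    exact (mul_le_of_le_one_left (abs_nonneg _) hb).trans h
  have hatom : |w r * (g r * (y r - b)) - 0| ≤ 2 * e + c * D :=
    abs_weight_mul_sub_le hw hsum (mul_nonneg hc hD) (g := fun l ↦ g l * (y l - b))
      (fun l hl ↦ by rw [abs_mul]; exact mul_le_mul (hg l hl) (hy l) (abs_nonneg _) hc) hcentered
  have hmass : p / 2 ≤ w r * g r := by
    linarith [(abs_le.1 (abs_weight_mul_sub_le hw hsum hc hg h)).1]
  rw [sub_zero, ← mul_assoc, abs_mul, abs_of_nonneg (by linarith)] at hatom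
  rw [le_div_iff₀ hp]
  linarith [mul_le_mul_of_nonneg_right hmass (abs_nonneg (y r - b))]

/-- The observable `f` must be close to `1` at the atom `r`, and `w * f` has total mass close to
`a`. -/
lemma abs_weight_sub_le {f g w : κ → ℝ} {r : κ} {a p e c L : ℝ} (hp : 0 < p) (ha : p ≤ a)
    (hw : ∀ l, 0 ≤ w l) (hsum : ∑ l, w l = 1) (hc : 0 ≤ c) (hL : 1 ≤ L) (hfL : ∀ l, |f l| ≤ L)
    (hf : ∀ l, l ≠ r → |f l| ≤ c) (hg : ∀ l, l ≠ r → |g l| ≤ c)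
    (hfa : |∑ l, w l * f l - a| ≤ e) (hga : |∑ l, w l * g l - a| ≤ e)
    (hgf : |∑ l, w l * (g l * f l) - a| ≤ e) (hsmall : e + c ≤ p / 2) :
    |a - w r| ≤ 2 * (2 * e + c * (2 * L)) / p + (e + c) := by
  have hfr : |f r - 1| ≤ 2 * (2 * e + c * (2 * L)) / p :=
    abs_observable_sub_le hp ha hw hsum hc abs_one.le
      (fun l ↦ (abs_sub _ _).trans (by rw [abs_one]; linarith [hfL l])) hg hga (by simpa using hgf)
      hsmall
  have hw1 : w r ≤ 1 := hsum ▸ single_le_sum (fun j _ ↦ hw j) (mem_univ _)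
  calc |a - w r| = |w r * (f r - 1) - (w r * f r - a)| := by ring_nf
    _ ≤ w r * |f r - 1| + |w r * f r - a| := by
        refine (abs_sub _ _).trans_eq ?_
        rw [abs_mul, abs_of_nonneg (hw r)]
    _ ≤ |f r - 1| + |w r * f r - a| := by
        gcongr
        exact mul_le_of_le_one_left (abs_nonneg _) hw1
    _ ≤ _ := add_le_add hfr (abs_weight_mul_sub_le hw hsum hc hf hfa)

end Alignment

section Recovery

variable {κ : Type*} [Fintype κ] [DecidableEq κ] {F G : Matrix κ κ ℝ} {w w' x x' : κ → ℝ}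
  {e p L ζ : ℝ}

/-- The precision to which a mixture with `k` components, weights at least `p` and
`ζ`-separated means is determined by test polynomials that are bounded by `L` and whose
expectations are known up to `e`, up to a constant factor. -/
noncomputable def recoveryError (k : ℕ) (e p L ζ : ℝ) : ℝ := k * L ^ 2 * e / (p ^ 2 * ζ)

lemma recoveryError_bounds {k : ℕ} (hk : 1 ≤ k) (he : 0 ≤ e) (hp : 0 < p) (hp1 : p ≤ 1)
    (hL : 1 ≤ L) (hζ : 0 < ζ) (hζ1 : ζ ≤ 1) :
    0 ≤ recoveryError k e p L ζ ∧ k * e ≤ p * recoveryError k e p L ζ ∧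
      e ≤ p * recoveryError k e p L ζ ∧
      8 * k * L * e / (p * ζ) ≤ 8 * (p * recoveryError k e p L ζ) ∧
      8 * k * L * e / (p * ζ) * L = 8 * (p * recoveryError k e p L ζ) := by
  have hk1 : (1 : ℝ) ≤ k := by exact_mod_cast hk
  have hmul : 8 * k * L * e / (p * ζ) * L = 8 * (p * recoveryError k e p L ζ) := by
    rw [recoveryError]
    field_simp
  have hke : k * e ≤ p * recoveryError k e p L ζ := by
    have : 1 ≤ L ^ 2 / (p * ζ) := by
      rw [one_le_div (by positivity)]
      exact (mul_le_one₀ hp1 hζ.le hζ1).trans (one_le_pow₀ hL)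
    calc k * e ≤ k * e * (L ^ 2 / (p * ζ)) := le_mul_of_one_le_right (by positivity) this
      _ = p * recoveryError k e p L ζ := by rw [recoveryError]; field_simp
  refine ⟨by unfold recoveryError; positivity, hke,
    (le_mul_of_one_le_left he hk1).trans hke, ?_, hmul⟩
  rw [← hmul]
  exact le_mul_of_one_le_right (by positivity) hL

theorem ApproxDiagonalizes.exists_perm_close [Nonempty κ] (hζ : 0 < ζ) (hζ1 : ζ ≤ 1) (hL : 1 ≤ L)
    (hp : 0 < p) (hw : ∀ j, p ≤ w j) (hwsum : ∑ l, w l = 1) (hw' : ∀ l, 0 ≤ w' l)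
    (hsum : ∑ l, w' l = 1) (hx : ∀ j, |x j| ≤ 1) (hxζ : ∀ j j', j ≠ j' → ζ ≤ |x j - x j'|)
    (hF : ∀ j l, |F j l| ≤ L) (hG : ∀ j l, |G j l| ≤ L) (h : ApproxDiagonalizes e F G w w')
    (hX : ApproxDiagonalizes e F G (w * x) (w' * x'))
    (hF1 : ∀ j, |∑ l, w' l * F j l - w j| ≤ e) (hG1 : ∀ j, |∑ l, w' l * G j l - w j| ≤ e)
    (hsmall : 50 * recoveryError (Fintype.card κ) e p L ζ ≤ 1) :
    ∃ ρ : Equiv.Perm κ,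
      (∀ j, |w j - w' (ρ j)| ≤ 50 * recoveryError (Fintype.card κ) e p L ζ) ∧
      ∀ j b (y : κ → ℝ), |b| ≤ 1 → (∀ l, |y l - b| ≤ 1) →
        (|∑ l, w' l * (F j l * y l) - w j * b| ≤ e ∨ |∑ l, w' l * (G j l * y l) - w j * b| ≤ e) →
        |b - y (ρ j)| ≤ 50 * recoveryError (Fintype.card κ) e p L ζ := by
  have he : 0 ≤ e := (abs_nonneg _).trans (hF1 (Classical.arbitrary κ))
  have hp1 : p ≤ 1 := (hw (Classical.arbitrary κ)).trans <| hwsum ▸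
    single_le_sum (fun j _ ↦ hp.le.trans (hw j)) (mem_univ _)
  obtain ⟨hE, hke, heE, hcE, hcL⟩ :=
    recoveryError_bounds (Fintype.card_pos (α := κ)) he hp hp1 hL hζ hζ1
  set E := recoveryError (Fintype.card κ) e p L ζ with hEdef
  set c := 8 * Fintype.card κ * L * e / (p * ζ)
  have hpE : p * E ≤ E := mul_le_of_le_one_left hE hp1
  have hc : 0 ≤ c := by positivity
  obtain ⟨ρ, hρ⟩ := h.exists_perm_abs_le hζ (by linarith) hp hw hw' hsum hx hxζ hF hG hX
    (by rw [mul_div_assoc', div_le_iff₀ hp]; nlinarith) (by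
      have : 8 * Fintype.card κ * L ^ 2 * e / p ^ 2 = 8 * E * ζ := by
        rw [hEdef, recoveryError]
        field_simp
      rw [this]
      nlinarith)
  have hec : e + c ≤ p / 2 := by nlinarith
  refine ⟨ρ, fun j ↦ ?_, fun j b y hb hy htest ↦ ?_⟩
  · have hGF : |∑ l, w' l * (G j l * F j l) - w j| ≤ e := h.symm.abs_sum_sub_le j
    have hbound : 2 * (2 * e + c * (2 * L)) / p ≤ 36 * E := by
      rw [div_le_iff₀ hp]
      linarith
    linarith [abs_weight_sub_le hp (hw j) hw' hsum hc hL (hF j) (fun l hl ↦ (hρ j l hl).1)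
      (fun l hl ↦ (hρ j l hl).2) (hF1 j) (hG1 j) hGF hec]
  · have hbound : 2 * (2 * e + c * 1) / p ≤ 50 * E := by
      rw [div_le_iff₀ hp]
      linarith [mul_nonneg hp.le hE]
    rw [abs_sub_comm]
    rcases htest with hFy | hGy
    · exact (abs_observable_sub_le hp (hw j) hw' hsum hc hb hy (fun l hl ↦ (hρ j l hl).1)
        (hF1 j) hFy hec).trans hbound
    · exact (abs_observable_sub_le hp (hw j) hw' hsum hc hb hy (fun l hl ↦ (hρ j l hl).2)
        (hG1 j) hGy hec).trans hbound

end Recovery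

section Stability

variable {t : ℕ}

lemma abs_le_one_of_mem_Icc {a : ℝ} (ha : a ∈ Set.Icc (0 : ℝ) 1) : |a| ≤ 1 :=
  abs_le.2 ⟨by linarith [ha.1], ha.2⟩

lemma abs_sub_le_one_of_mem_Icc {a b : ℝ} (ha : a ∈ Set.Icc (0 : ℝ) 1)
    (hb : b ∈ Set.Icc (0 : ℝ) 1) : |a - b| ≤ 1 :=
  abs_le.2 ⟨by linarith [ha.1, hb.2], by linarith [ha.2, hb.1]⟩

variable {w w' : Fin (t + 1) → ℝ} {ζ η : ℝ}

lemma MomentsClose.abs_sum_lagrangeMatrix_sub_le {ι : Type*} {m m' : ι → Fin (t + 1) → ℝ}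
    (h : MomentsClose η w w' m m') (hζ : 0 < ζ) (hm : ∀ i j j', j ≠ j' → ζ ≤ |m i j - m i j'|)
    (h01 : ∀ i j, m i j ∈ Set.Icc (0 : ℝ) 1) {u : Fin t → ι} (hu : Function.Injective u) {i : ι}
    (hi : i ∉ Set.range u) {a b : ℝ} (hab : |a| + |b| = 1) (j : Fin (t + 1)) :
    |∑ l, w' l * (lagrangeMatrix (fun s ↦ m (u s)) (fun s ↦ m' (u s)) j l * (a * m' i l + b)) -
        w j * (a * m i j + b)| ≤ η * (2 / ζ) ^ t := by
  set f := (lagrange (fun s ↦ m (u s)) j).sumElim (.single a b)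
  have hexpect : f.expect w (fun s ↦ m (Sum.elim u (fun _ ↦ i) s)) = w j * (a * m i j + b) := by
    simp [f, AffineProd.expect, AffineProd.eval_sumElim, AffineProd.eval_single,
      lagrange_eval_column (m := fun s ↦ m (u s)) fun _ ↦ injective_of_separated hζ (hm _)]
  have hnorm : f.coeffNorm ≤ (2 / ζ) ^ t := by
    rw [AffineProd.coeffNorm_sumElim, AffineProd.coeffNorm_single, hab, mul_one]
    exact coeffNorm_lagrange_le hζ (fun s ↦ hm _) (fun s ↦ h01 _) j
  have hinj : Function.Injective (Sum.elim u fun _ : Unit ↦ i) :=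
    hu.sumElim (Function.injective_of_subsingleton _) fun s _ hs ↦ hi ⟨s, hs⟩
  have := (h.comp hinj).abs_expect_sub_le f
  rw [hexpect] at this
  simp only [AffineProd.expect, AffineProd.eval_sumElim, AffineProd.eval_single, f] at this
  exact this.trans (mul_le_mul_of_nonneg_left hnorm h.nonneg)

lemma MomentsClose.approxDiagonalizes {m m' : (Fin t ⊕ Fin t) ⊕ Unit → Fin (t + 1) → ℝ}
    (h : MomentsClose η w w' m m') (hζ : 0 < ζ) (hm : ∀ i j j', j ≠ j' → ζ ≤ |m i j - m i j'|)
    (h01 : ∀ i j, m i j ∈ Set.Icc (0 : ℝ) 1) {a b : ℝ} (hab : |a| + |b| = 1) :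
    ApproxDiagonalizes (η * ((2 / ζ) ^ t) ^ 2)
      (lagrangeMatrix (fun i ↦ m (.inl (.inl i))) fun i ↦ m' (.inl (.inl i)))
      (lagrangeMatrix (fun i ↦ m (.inl (.inr i))) fun i ↦ m' (.inl (.inr i)))
      (fun l ↦ w l * (a * m (.inr ()) l + b)) (fun l ↦ w' l * (a * m' (.inr ()) l + b)) := by
  intro i j
  set f₁ := lagrange (fun i ↦ m (.inl (.inl i))) i
  set f₂ := lagrange (fun i ↦ m (.inl (.inr i))) j
  set f := (f₁.sumElim f₂).sumElim (.single a b)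
  have hexpect : ∀ (v : Fin (t + 1) → ℝ) (m'' : (Fin t ⊕ Fin t) ⊕ Unit → Fin (t + 1) → ℝ),
      f.expect v m'' = (lagrangeMatrix (fun i ↦ m (.inl (.inl i))) (fun i ↦ m'' (.inl (.inl i))) *
        Matrix.diagonal (fun l ↦ v l * (a * m'' (.inr ()) l + b)) *
        (lagrangeMatrix (fun i ↦ m (.inl (.inr i))) fun i ↦ m'' (.inl (.inr i)))ᵀ) i j := by
    intro v m''
    rw [mul_diagonal_mul_transpose_apply]
    refine sum_congr rfl fun l _ ↦ ?_
    rw [AffineProd.eval_sumElim, AffineProd.eval_sumElim, AffineProd.eval_single,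
      lagrangeMatrix, lagrangeMatrix, Matrix.of_apply, Matrix.of_apply]
    ring
  have hnorm : f.coeffNorm ≤ ((2 / ζ) ^ t) ^ 2 := by
    rw [AffineProd.coeffNorm_sumElim, AffineProd.coeffNorm_sumElim, AffineProd.coeffNorm_single,
      hab, mul_one, sq]
    exact mul_le_mul (coeffNorm_lagrange_le hζ (fun _ ↦ hm _) (fun _ ↦ h01 _) i)
      (coeffNorm_lagrange_le hζ (fun _ ↦ hm _) (fun _ ↦ h01 _) j) f₂.coeffNorm_nonneg
      (by positivity)
  have := h.abs_expect_sub_le f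
  rw [hexpect, hexpect, lagrangeMatrix_self fun _ ↦ injective_of_separated hζ (hm _),
    lagrangeMatrix_self fun _ ↦ injective_of_separated hζ (hm _), Matrix.transpose_one,
    one_mul, mul_one] at this
  exact this.trans (mul_le_mul_of_nonneg_left hnorm h.nonneg)

theorem MomentsClose.exists_perm_close {ι : Type*} {m m' : ι → Fin (t + 1) → ℝ} {p : ℝ}
    (h : MomentsClose η w w' m m') {u : (Fin t ⊕ Fin t) ⊕ Unit → ι} (hu : Function.Injective u)
    (hζ : 0 < ζ) (hζ1 : ζ ≤ 1) (hp : 0 < p) (hw : ∀ j, p ≤ w j) (hwsum : ∑ j, w j = 1)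
    (hw' : ∀ j, 0 ≤ w' j) (hwsum' : ∑ j, w' j = 1) (h01 : ∀ i j, m i j ∈ Set.Icc (0 : ℝ) 1)
    (h01' : ∀ i j, m' i j ∈ Set.Icc (0 : ℝ) 1) (hm : ∀ i j j', j ≠ j' → ζ ≤ |m i j - m i j'|)
    (hsmall : 50 * recoveryError (t + 1) (η * ((2 / ζ) ^ t) ^ 2) p ((2 / ζ) ^ t) ζ ≤ 1) :
    ∃ ρ : Equiv.Perm (Fin (t + 1)), ∀ j,
      |w j - w' (ρ j)| ≤ 50 * recoveryError (t + 1) (η * ((2 / ζ) ^ t) ^ 2) p ((2 / ζ) ^ t) ζ ∧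
      ∀ i, |m i j - m' i (ρ j)| ≤
        50 * recoveryError (t + 1) (η * ((2 / ζ) ^ t) ^ 2) p ((2 / ζ) ^ t) ζ := by
  have hL : 1 ≤ (2 / ζ) ^ t := one_le_pow₀ (by rw [le_div_iff₀ hζ]; linarith)
  have hηL : η * (2 / ζ) ^ t ≤ η * ((2 / ζ) ^ t) ^ 2 :=
    mul_le_mul_of_nonneg_left (le_self_pow₀ hL two_ne_zero) h.nonneg
  set u₁ : Fin t → ι := fun s ↦ u (.inl (.inl s))
  set u₂ : Fin t → ι := fun s ↦ u (.inl (.inr s))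
  have hu₁ : Function.Injective u₁ := hu.comp (Sum.inl_injective.comp Sum.inl_injective)
  have hu₂ : Function.Injective u₂ := hu.comp (Sum.inl_injective.comp Sum.inr_injective)
  have hdisj : ∀ i ∈ Set.range u₁, i ∉ Set.range u₂ := by
    rintro _ ⟨s, rfl⟩ ⟨s', hs⟩
    exact absurd (hu hs) (by simp)
  have hu₀ : ∀ v : Fin t → Fin t ⊕ Fin t, u (.inr ()) ∉ Set.range fun s ↦ u (.inl (v s)) := by
    rintro v ⟨s, hs⟩
    exact absurd (hu hs) (by simp)
  have hdiag {a b : ℝ} (hab : |a| + |b| = 1) :=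
    (h.comp hu).approxDiagonalizes hζ (fun _ ↦ hm _) (fun _ ↦ h01 _) hab
  have htest {v : Fin t → ι} (hv : Function.Injective v) {i : ι} (hi : i ∉ Set.range v) {a b : ℝ}
      (hab : |a| + |b| = 1) (j : Fin (t + 1)) :=
    (h.abs_sum_lagrangeMatrix_sub_le hζ hm h01 hv hi hab j).trans hηL
  obtain ⟨ρ, hρw, hρm⟩ := ApproxDiagonalizes.exists_perm_close (x := m (u (.inr ())))
    (x' := m' (u (.inr ())))
    (F := lagrangeMatrix (fun s ↦ m (u₁ s)) fun s ↦ m' (u₁ s))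
    (G := lagrangeMatrix (fun s ↦ m (u₂ s)) fun s ↦ m' (u₂ s))
    hζ hζ1 hL hp hw hwsum hw' hwsum' (fun j ↦ abs_le_one_of_mem_Icc (h01 _ j)) (hm _)
    (abs_lagrangeMatrix_le hζ (fun _ ↦ hm _) (fun _ ↦ h01 _) fun _ ↦ h01' _)
    (abs_lagrangeMatrix_le hζ (fun _ ↦ hm _) (fun _ ↦ h01 _) fun _ ↦ h01' _)
    (by simpa using hdiag (a := 0) (b := 1) (by simp))
    (by simpa [Pi.mul_def] using hdiag (a := 1) (b := 0) (by simp))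
    (fun j ↦ by simpa using htest hu₁ (hu₀ .inl) (a := 0) (b := 1) (by simp) j)
    (fun j ↦ by simpa using htest hu₂ (hu₀ .inr) (a := 0) (b := 1) (by simp) j)
    (by rwa [Fintype.card_fin])
  rw [Fintype.card_fin] at hρw hρm
  refine ⟨ρ, fun j ↦ ⟨hρw j, fun i ↦ hρm j (m i j) (m' i) (abs_le_one_of_mem_Icc (h01 i j))
    (fun l ↦ abs_sub_le_one_of_mem_Icc (h01' i l) (h01 i j)) ?_⟩⟩
  by_cases hi : i ∈ Set.range u₁
  · exact .inr (by simpa using htest hu₂ (hdisj i hi) (a := 1) (b := 0) (by simp) j)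
  · exact .inl (by simpa using htest hu₁ hi (a := 1) (b := 0) (by simp) j)

end Stability

section ModelDist

variable {n k : ℕ} {θ θ' : Params n k}

lemma modelDist_le [NeZero n] [NeZero k] {K : ℝ} (ρ : Equiv.Perm (Fin k))
    (hw : ∀ j, |θ.1 j - θ'.1 (ρ j)| ≤ K) (hm : ∀ i j, |θ.2 i j - θ'.2 i (ρ j)| ≤ K) :
    modelDist θ θ' ≤ K :=
  (ciInf_le (Set.finite_range _).bddBelow ρ).trans
    (max_le (ciSup_le hw) (ciSup_le fun i ↦ ciSup_le (hm i)))

lemma modelDist_le_one [NeZero n] [NeZero k] (hθ : θ ∈ models n k) (hθ' : θ' ∈ models n k) :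
    modelDist θ θ' ≤ 1 :=
  modelDist_le (.refl _)
    (fun j ↦ abs_sub_le_one_of_mem_Icc (mem_Icc_of_mem_stdSimplex hθ.1 j)
      (mem_Icc_of_mem_stdSimplex hθ'.1 j))
    fun i j ↦ abs_sub_le_one_of_mem_Icc (hθ.2 i j) (hθ'.2 i j)

/-- The factor by which errors in the moments are amplified in the parameters. -/
noncomputable def stabilityConst (k : ℕ) (ζ p : ℝ) : ℝ := 50 * k * (2 / ζ) ^ (4 * k) / p ^ 2

lemma recoveryError_le_stabilityConst {t : ℕ} {ζ p η : ℝ} (hζ : 0 < ζ) (hζ1 : ζ ≤ 1)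
    (hη : 0 ≤ η) :
    50 * recoveryError (t + 1) (η * ((2 / ζ) ^ t) ^ 2) p ((2 / ζ) ^ t) ζ ≤
      stabilityConst (t + 1) ζ p * η := by
  have h2ζ : 1 ≤ 2 / ζ := by rw [le_div_iff₀ hζ]; linarith
  have hpow : (2 / ζ) ^ (4 * t) * (1 / ζ) ≤ (2 / ζ) ^ (4 * (t + 1)) := by
    rw [mul_add, mul_one, pow_add]
    gcongr
    exact (div_le_div_of_nonneg_right one_le_two hζ.le).trans (le_self_pow₀ h2ζ (by norm_num))
  calc _ = 50 * (t + 1 : ℕ) * ((2 / ζ) ^ (4 * t) * (1 / ζ)) / p ^ 2 * η := by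
        rw [recoveryError]; ring
    _ ≤ stabilityConst (t + 1) ζ p * η := by rw [stabilityConst]; gcongr

theorem modelDist_le_of_momentsClose (hk : 1 ≤ k) (hn : 2 * k - 1 ≤ n) {ζ p η : ℝ} (hζ : 0 < ζ)
    (hζ1 : ζ ≤ 1) (hp : 0 < p) (hθ : θ ∈ separatedModels n k ζ p) (hθ' : θ' ∈ models n k)
    (h : MomentsClose η θ.1 θ'.1 θ.2 θ'.2) (hη : stabilityConst k ζ p * η ≤ 1) :
    modelDist θ θ' ≤ stabilityConst k ζ p * η := by
  obtain ⟨t, rfl⟩ : ∃ t, k = t + 1 := ⟨k - 1, by omega⟩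
  have : NeZero n := ⟨by omega⟩
  obtain ⟨⟨⟨_, hwsum⟩, h01⟩, hw, hm⟩ := hθ
  obtain ⟨⟨hw', hwsum'⟩, h01'⟩ := hθ'
  obtain ⟨u⟩ : Nonempty ((Fin t ⊕ Fin t) ⊕ Unit ↪ Fin n) :=
    Function.Embedding.nonempty_of_card_le (by simp; omega)
  have hK := recoveryError_le_stabilityConst (t := t) (p := p) hζ hζ1 h.nonneg
  obtain ⟨ρ, hρ⟩ := h.exists_perm_close u.injective hζ hζ1 hp hw hwsum hw' hwsum' h01 h01' hm
    (hK.trans hη)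
  exact (modelDist_le ρ (fun j ↦ (hρ j).1) fun i j ↦ (hρ j).2 i).trans hK

end ModelDist

section PrimitiveRecursion

variable {α : Type*} [Primcodable α]

lemma primrec_foldr_range {op : ℕ → ℕ → ℕ} (hop : Primrec₂ op) (e : ℕ) {n : α → ℕ}
    {g : α → ℕ → ℕ} (hn : Primrec n) (hg : Primrec₂ g) :
    Primrec fun a ↦ ((List.range (n a)).map (g a)).foldr op e :=
  Primrec.list_foldr (Primrec.list_map (Primrec.list_range.comp hn) hg) (.const e)
    (hop.comp (Primrec.fst.comp .snd) (Primrec.snd.comp .snd)).to₂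

lemma primrec_sum_range {n : α → ℕ} {g : α → ℕ → ℕ} (hn : Primrec n) (hg : Primrec₂ g) :
    Primrec fun a ↦ ∑ i ∈ range (n a), g a i :=
  primrec_foldr_range Primrec.nat_add 0 hn hg

lemma primrec_prod_range {n : α → ℕ} {g : α → ℕ → ℕ} (hn : Primrec n) (hg : Primrec₂ g) :
    Primrec fun a ↦ ∏ i ∈ range (n a), g a i :=
  primrec_foldr_range Primrec.nat_mul 1 hn hg

lemma primrec_pow : Primrec₂ fun a b : ℕ ↦ a ^ b :=
  Primrec₂.unpaired'.1 Nat.Primrec.pow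

lemma primrec_dist : Primrec₂ Nat.dist :=
  Primrec.nat_add.comp₂ Primrec.nat_sub (Primrec.nat_sub.comp₂ .right .left)

end PrimitiveRecursion

section Digits

/-- The `i`-th digit of `c` in base `b`. -/
def digit (b c i : ℕ) : ℕ := c / b ^ i % b

lemma exists_digit_eq {b n : ℕ} (d : Fin n → Fin b) :
    ∃ c < b ^ n, ∀ i : Fin n, digit b c i = d i :=
  ⟨finFunctionFinEquiv d, (finFunctionFinEquiv d).2, fun i ↦ by
    rw [digit, ← finFunctionFinEquiv_symm_apply_val, Equiv.symm_apply_apply]⟩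

/-- The subset of `Fin n` whose indicator function has the binary digits of `s` as values. -/
def digitSet (n s : ℕ) : Finset (Fin n) := univ.filter fun i ↦ digit 2 s i = 1

lemma exists_digitSet_eq {n : ℕ} (S : Finset (Fin n)) : ∃ s < 2 ^ n, digitSet n s = S := by
  obtain ⟨s, hs, h⟩ := exists_digit_eq fun i ↦ if i ∈ S then (1 : Fin 2) else 0
  refine ⟨s, hs, ?_⟩
  ext i
  by_cases hi : i ∈ S <;> simp [digitSet, h, hi]

/-- The entry `(i, j)` of the table with `k` columns and entries in `{0, …, Q}` whose entries are
the digits of `c` in base `Q + 1`. -/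
def entry (Q k c i j : ℕ) : ℕ := digit (Q + 1) c (j + k * i)

lemma entry_le (Q k c i j : ℕ) : entry Q k c i j ≤ Q := Nat.lt_succ_iff.1 (Nat.mod_lt _ Q.succ_pos)

lemma exists_entry_eq {Q n k : ℕ} {T : Fin n → Fin k → ℕ} (hT : ∀ i j, T i j ≤ Q) :
    ∃ c < (Q + 1) ^ (n * k), ∀ (i : Fin n) (j : Fin k), entry Q k c i j = T i j := by
  obtain ⟨c, hc, h⟩ := exists_digit_eq fun x : Fin (n * k) ↦
    (⟨T (finProdFinEquiv.symm x).1 (finProdFinEquiv.symm x).2,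
      Nat.lt_succ_iff.2 (hT _ _)⟩ : Fin (Q + 1))
  refine ⟨c, hc, fun i j ↦ ?_⟩
  simpa [entry] using h (finProdFinEquiv (i, j))

end Digits

section Estimator

/-- `Q ^ n` times the product of the numbers `y i / Q` over the set of indices coded by `s`. -/
def scaledProd (Q n s : ℕ) (y : ℕ → ℕ) : ℕ := ∏ i ∈ range n, if digit 2 s i = 1 then y i else Q

/-- `Q ^ (n + 1)` times the moment, over the set of observables coded by `s`, of the model whose
weights and means have as numerators over `Q` row `0` and the rows `1, …, n` of the table `T`. -/
def gridMoment (Q n k : ℕ) (T : ℕ → ℕ → ℕ) (s : ℕ) : ℕ :=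
  ∑ j ∈ range k, T 0 j * scaledProd Q n s fun i ↦ T (i + 1) j

/-- `D.length * Q ^ n` times the empirical moment, over the set of observables coded by `s`, of
data with numerators `D` over `Q`. -/
def dataMoment (Q n : ℕ) (D : List (List ℕ)) (s : ℕ) : ℕ :=
  ∑ r ∈ range D.length, scaledProd Q n s ((D.getD r []).getD · 0)

/-- The total deviation of the moments of the model with code `c` from the empirical moments, over
the common denominator `D.length * Q ^ (n + 1)`. -/
def discrepancy (Q n k : ℕ) (D : List (List ℕ)) (c : ℕ) : ℕ :=
  ∑ s ∈ range (2 ^ n), Nat.dist (D.length * gridMoment Q n k (entry Q k c) s)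
    (Q * dataMoment Q n D s)

/-- `c` codes a table whose row `0`, divided by `Q`, is a probability vector. -/
def IsModelCode (Q k c : ℕ) : Prop := ∑ j ∈ range k, entry Q k c 0 j = Q

/-- The number of codes of models with `k` components and `n` observables. -/
def numCodes (Q n k : ℕ) : ℕ := (Q + 1) ^ ((n + 1) * k)

/-- `c` codes a model of minimal discrepancy. -/
def IsBestCode (Q n k : ℕ) (D : List (List ℕ)) (c : ℕ) : Prop :=
  IsModelCode Q k c ∧
    ∀ c' < numCodes Q n k, ¬IsModelCode Q k c' ∨ discrepancy Q n k D c ≤ discrepancy Q n k D c'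

instance (Q n k : ℕ) (D : List (List ℕ)) : DecidablePred (IsBestCode Q n k D) :=
  fun _ ↦ inferInstanceAs (Decidable (_ = _ ∧ ∀ _ < _, ¬_ = _ ∨ _))

/-- The code of a model of minimal discrepancy. -/
def bestCode (Q n k : ℕ) (D : List (List ℕ)) : ℕ :=
  Nat.findGreatest (IsBestCode Q n k D) (numCodes Q n k)

/-- The minimum-discrepancy estimator on the grid of width `2 ^ (-D.length)`. -/
def estimator (p : ℕ × List (List ℕ)) : ℕ × List ℕ × List (List ℕ) :=
  let Q := 2 ^ p.2.length
  let c := bestCode Q (2 * p.1 - 1) p.1 p.2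
  (Q, (List.range p.1).map (entry Q p.1 c 0),
    (List.range (2 * p.1 - 1)).map fun i ↦ (List.range p.1).map (entry Q p.1 c (i + 1)))

variable {α : Type*} [Primcodable α] {Q n k c s i j : α → ℕ} {D : α → List (List ℕ)}

lemma primrec_digit {b : α → ℕ} (hb : Primrec b) (hc : Primrec c) (hi : Primrec i) :
    Primrec fun a ↦ digit (b a) (c a) (i a) :=
  Primrec.nat_mod.comp (Primrec.nat_div.comp hc (primrec_pow.comp hb hi)) hb

lemma primrec_entry (hQ : Primrec Q) (hk : Primrec k) (hc : Primrec c) (hi : Primrec i)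
    (hj : Primrec j) : Primrec fun a ↦ entry (Q a) (k a) (c a) (i a) (j a) :=
  primrec_digit (Primrec.succ.comp hQ) hc
    (Primrec.nat_add.comp hj (Primrec.nat_mul.comp hk hi))

lemma primrec_scaledProd (hQ : Primrec Q) (hn : Primrec n) (hs : Primrec s) {y : α → ℕ → ℕ}
    (hy : Primrec₂ y) : Primrec fun a ↦ scaledProd (Q a) (n a) (s a) (y a) :=
  primrec_prod_range hn (Primrec.ite (Primrec.eq.comp
    (primrec_digit (.const 2) (hs.comp .fst) .snd) (.const 1)) hy (hQ.comp .fst))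

lemma primrec_gridMoment (hQ : Primrec Q) (hn : Primrec n) (hk : Primrec k) (hc : Primrec c)
    (hs : Primrec s) :
    Primrec fun a ↦ gridMoment (Q a) (n a) (k a) (entry (Q a) (k a) (c a)) (s a) := by
  have hentry : Primrec₂ fun (p : α × ℕ) i ↦ entry (Q p.1) (k p.1) (c p.1) (i + 1) p.2 :=
    primrec_entry (hQ.comp (Primrec.fst.comp .fst)) (hk.comp (Primrec.fst.comp .fst))
      (hc.comp (Primrec.fst.comp .fst)) (Primrec.succ.comp .snd) (Primrec.snd.comp .fst)
  exact primrec_sum_range hk (Primrec.nat_mul.comp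
    (primrec_entry (hQ.comp .fst) (hk.comp .fst) (hc.comp .fst) (.const 0) .snd)
    (primrec_scaledProd (hQ.comp .fst) (hn.comp .fst) (hs.comp .fst) hentry))

lemma primrec_dataMoment (hQ : Primrec Q) (hn : Primrec n) (hD : Primrec D) (hs : Primrec s) :
    Primrec fun a ↦ dataMoment (Q a) (n a) (D a) (s a) := by
  have hentry : Primrec₂ fun (p : α × ℕ) i ↦ ((D p.1).getD p.2 []).getD i 0 :=
    (Primrec.list_getD 0).comp ((Primrec.list_getD []).comp (hD.comp (Primrec.fst.comp .fst))
      (Primrec.snd.comp .fst)) .snd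
  exact primrec_sum_range (Primrec.list_length.comp hD)
    (primrec_scaledProd (hQ.comp .fst) (hn.comp .fst) (hs.comp .fst) hentry)

lemma primrec_discrepancy (hQ : Primrec Q) (hn : Primrec n) (hk : Primrec k) (hD : Primrec D)
    (hc : Primrec c) : Primrec fun a ↦ discrepancy (Q a) (n a) (k a) (D a) (c a) :=
  primrec_sum_range (primrec_pow.comp (.const 2) hn) (primrec_dist.comp
    (Primrec.nat_mul.comp (Primrec.list_length.comp (hD.comp .fst))
      (primrec_gridMoment (hQ.comp .fst) (hn.comp .fst) (hk.comp .fst) (hc.comp .fst) .snd))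
    (Primrec.nat_mul.comp (hQ.comp .fst)
      (primrec_dataMoment (hQ.comp .fst) (hn.comp .fst) (hD.comp .fst) .snd)))

lemma primrec_numCodes (hQ : Primrec Q) (hn : Primrec n) (hk : Primrec k) :
    Primrec fun a ↦ numCodes (Q a) (n a) (k a) :=
  primrec_pow.comp (Primrec.succ.comp hQ) (Primrec.nat_mul.comp (Primrec.succ.comp hn) hk)

lemma primrecPred_isModelCode (hQ : Primrec Q) (hk : Primrec k) (hc : Primrec c) :
    PrimrecPred fun a ↦ IsModelCode (Q a) (k a) (c a) :=
  Primrec.eq.comp (primrec_sum_range hk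
    (primrec_entry (hQ.comp .fst) (hk.comp .fst) (hc.comp .fst) (.const 0) .snd)) hQ

lemma primrecPred_isBestCode (hQ : Primrec Q) (hn : Primrec n) (hk : Primrec k) (hD : Primrec D)
    (hc : Primrec c) : PrimrecPred fun a ↦ IsBestCode (Q a) (n a) (k a) (D a) (c a) := by
  have hrel : PrimrecRel fun c' a ↦ ¬IsModelCode (Q a) (k a) c' ∨
      discrepancy (Q a) (n a) (k a) (D a) (c a) ≤ discrepancy (Q a) (n a) (k a) (D a) c' :=
    (primrecPred_isModelCode (hQ.comp .snd) (hk.comp .snd) .fst).not.or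
      (Primrec.nat_le.comp ((primrec_discrepancy hQ hn hk hD hc).comp .snd)
        (primrec_discrepancy (hQ.comp .snd) (hn.comp .snd) (hk.comp .snd) (hD.comp .snd) .fst))
  exact (primrecPred_isModelCode hQ hk hc).and
    ((hrel.forall_mem_list.comp (Primrec.list_range.comp (primrec_numCodes hQ hn hk)) .id).of_eq
      fun a ↦ by simp only [List.mem_range, id])

lemma primrec_bestCode (hQ : Primrec Q) (hn : Primrec n) (hk : Primrec k) (hD : Primrec D) :
    Primrec fun a ↦ bestCode (Q a) (n a) (k a) (D a) :=
  Primrec.nat_findGreatest (primrec_numCodes hQ hn hk)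
    (primrecPred_isBestCode (hQ.comp .fst) (hn.comp .fst) (hk.comp .fst) (hD.comp .fst) .snd)

theorem primrec_estimator : Primrec estimator := by
  have hk : Primrec fun p : ℕ × List (List ℕ) ↦ p.1 := .fst
  have hn : Primrec fun p : ℕ × List (List ℕ) ↦ 2 * p.1 - 1 :=
    Primrec.pred.comp (Primrec.nat_mul.comp (.const 2) hk)
  have hQ : Primrec fun p : ℕ × List (List ℕ) ↦ 2 ^ p.2.length :=
    primrec_pow.comp (.const 2) (Primrec.list_length.comp .snd)
  have hc := primrec_bestCode hQ hn hk .snd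
  refine hQ.pair (.pair ?_ ?_)
  · exact Primrec.list_map (Primrec.list_range.comp hk)
      (primrec_entry (hQ.comp .fst) (hk.comp .fst) (hc.comp .fst) (.const 0) .snd)
  · refine Primrec.list_map (Primrec.list_range.comp hn)
      (Primrec.list_map (Primrec.list_range.comp (hk.comp .fst)) ?_)
    exact primrec_entry (hQ.comp (Primrec.fst.comp .fst)) (hk.comp (Primrec.fst.comp .fst))
      (hc.comp (Primrec.fst.comp .fst)) (Primrec.succ.comp (Primrec.snd.comp .fst)) .snd

end Estimator

section EstimatorSpec

variable {Q n k N : ℕ} {D : List (List ℕ)}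

/-- The parameters whose weights and means have as numerators over `Q` row `0` and the rows
`1, …, n` of the table `T`. -/
noncomputable def gridParams (n k Q : ℕ) (T : ℕ → ℕ → ℕ) : Params n k :=
  (fun j ↦ T 0 j / Q, fun i j ↦ T (i + 1) j / Q)

/-- The value of the `i`-th observable in the `r`-th sample, for data with numerators `D`
over `Q`. -/
noncomputable def dataValue (n Q : ℕ) (D : List (List ℕ)) (i : Fin n) (r : Fin D.length) : ℝ :=
  (D.getD r []).getD i 0 / Q

/-- The weights of the uniform distribution on `Fin N`: empirical moments are the moments of the
uniform mixture of the point masses at the samples. -/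
noncomputable def uniformWeight (N : ℕ) (_ : Fin N) : ℝ := (N : ℝ)⁻¹

lemma cast_natDist (a b : ℕ) : (Nat.dist a b : ℝ) = |(a : ℝ) - b| := by
  rcases le_total a b with h | h
  · rw [Nat.dist_eq_sub_of_le h, Nat.cast_sub h, abs_sub_comm,
      abs_of_nonneg (sub_nonneg.2 (Nat.cast_le.2 h))]
  · rw [Nat.dist_eq_sub_of_le_right h, Nat.cast_sub h,
      abs_of_nonneg (sub_nonneg.2 (Nat.cast_le.2 h))]

lemma cast_scaledProd (hQ : 0 < Q) (s : ℕ) (y : ℕ → ℕ) :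
    (scaledProd Q n s y : ℝ) = Q ^ n * ∏ i ∈ digitSet n s, (y i : ℝ) / Q := by
  have hQ' : (Q : ℝ) ≠ 0 := by positivity
  have hpow : (Q : ℝ) ^ n = ∏ _i : Fin n, (Q : ℝ) := by simp
  rw [scaledProd, prod_range, Nat.cast_prod, digitSet, prod_filter, hpow, ← prod_mul_distrib]
  refine prod_congr rfl fun i _ ↦ ?_
  split_ifs
  · field_simp
  · rw [mul_one]

lemma cast_gridMoment (hQ : 0 < Q) (T : ℕ → ℕ → ℕ) (s : ℕ) :
    (gridMoment Q n k T s : ℝ) =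
      Q ^ (n + 1) * moment (gridParams n k Q T).1 (gridParams n k Q T).2 (digitSet n s) := by
  rw [gridMoment, sum_range, Nat.cast_sum, moment, mul_sum]
  refine sum_congr rfl fun j _ ↦ ?_
  rw [Nat.cast_mul, cast_scaledProd hQ]
  simp only [gridParams]
  field_simp
  ring

lemma cast_dataMoment (hQ : 0 < Q) (hD : D ≠ []) (s : ℕ) :
    (dataMoment Q n D s : ℝ) =
      D.length * Q ^ n * moment (uniformWeight D.length) (dataValue n Q D) (digitSet n s) := by
  have hN : (D.length : ℝ) ≠ 0 := by simpa using hD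
  rw [dataMoment, sum_range, Nat.cast_sum, moment, mul_sum]
  refine sum_congr rfl fun r _ ↦ ?_
  rw [cast_scaledProd hQ]
  simp only [uniformWeight, dataValue]
  field_simp

lemma cast_discrepancy (hQ : 0 < Q) (hD : D ≠ []) (c : ℕ) :
    (discrepancy Q n k D c : ℝ) = D.length * Q ^ (n + 1) * ∑ s ∈ range (2 ^ n),
      |moment (gridParams n k Q (entry Q k c)).1 (gridParams n k Q (entry Q k c)).2 (digitSet n s) -
        moment (uniformWeight D.length) (dataValue n Q D) (digitSet n s)| := by
  rw [discrepancy, Nat.cast_sum, mul_sum]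
  refine sum_congr rfl fun s _ ↦ ?_
  rw [cast_natDist, Nat.cast_mul, Nat.cast_mul, cast_gridMoment hQ, cast_dataMoment hQ hD]
  nth_rw 1 [← abs_of_nonneg (show (0 : ℝ) ≤ D.length * Q ^ (n + 1) by positivity)]
  rw [← abs_mul]
  ring_nf

lemma gridParams_mem_models {T : ℕ → ℕ → ℕ} (hQ : 0 < Q) (hsum : ∑ j ∈ range k, T 0 j = Q)
    (hT : ∀ i j, T i j ≤ Q) : gridParams n k Q T ∈ models n k := by
  refine ⟨⟨fun j ↦ by simp only [gridParams]; positivity, ?_⟩, fun i j ↦ ⟨?_, ?_⟩⟩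
  · simp only [gridParams]
    rw [← sum_div, ← Nat.cast_sum, ← sum_range, hsum, div_self (by positivity)]
  · simp only [gridParams]
    positivity
  · exact div_le_one_of_le₀ (Nat.cast_le.2 (hT _ _)) (by positivity)

lemma readParams_estimator (k : ℕ) (D : List (List ℕ)) :
    readParams (2 * k - 1) k (estimator (k, D)) = gridParams (2 * k - 1) k (2 ^ D.length)
      (entry (2 ^ D.length) k (bestCode (2 ^ D.length) (2 * k - 1) k D)) := by
  ext i j <;> simp [readParams, estimator, gridParams]

lemma isBestCode_bestCode {c : ℕ} (hc : c < numCodes Q n k) (hmodel : IsModelCode Q k c) :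
    IsBestCode Q n k D (bestCode Q n k D) := by
  classical
  obtain ⟨b, hb, hmin⟩ := exists_min_image ((range (numCodes Q n k)).filter (IsModelCode Q k))
    (discrepancy Q n k D) ⟨c, mem_filter.2 ⟨mem_range.2 hc, hmodel⟩⟩
  rw [mem_filter, mem_range] at hb
  refine Nat.findGreatest_spec hb.1.le ⟨hb.2, fun c' hc' ↦ ?_⟩
  by_cases hmodel' : IsModelCode Q k c'
  · exact .inr (hmin c' (mem_filter.2 ⟨mem_range.2 hc', hmodel'⟩))
  · exact .inl hmodel'

theorem momentsClose_bestCode (hQ : 0 < Q) (hD : D ≠ []) {c : ℕ} (hc : c < numCodes Q n k)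
    (hmodel : IsModelCode Q k c) {η : ℝ}
    (h : MomentsClose η (gridParams n k Q (entry Q k c)).1 (uniformWeight D.length)
      (gridParams n k Q (entry Q k c)).2 (dataValue n Q D)) :
    MomentsClose (2 ^ n * η) (gridParams n k Q (entry Q k (bestCode Q n k D))).1
      (uniformWeight D.length) (gridParams n k Q (entry Q k (bestCode Q n k D))).2
      (dataValue n Q D) := by
  intro S
  obtain ⟨s, hs, rfl⟩ := exists_digitSet_eq S
  have hle := Nat.cast_le (α := ℝ).2
    (((isBestCode_bestCode (D := D) hc hmodel).2 c hc).resolve_left (not_not.2 hmodel))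
  have hN : 0 < D.length := List.length_pos_iff.2 hD
  rw [cast_discrepancy hQ hD, cast_discrepancy hQ hD, mul_le_mul_iff_right₀ (by positivity)] at hle
  refine (single_le_sum (f := fun s ↦ |moment _ _ (digitSet n s) - moment _ _ (digitSet n s)|)
    (fun _ _ ↦ abs_nonneg _) (mem_range.2 hs)).trans (hle.trans ?_)
  exact (sum_le_card_nsmul _ _ _ fun s _ ↦ h _).trans_eq (by simp)

end EstimatorSpec

section Rounding

variable {ι κ κ' κ'' : Type*} [Fintype κ] [Fintype κ'] [Fintype κ'']

lemma MomentsClose.symm {η : ℝ} {w : κ → ℝ} {w' : κ' → ℝ} {m : ι → κ → ℝ} {m' : ι → κ' → ℝ}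
    (h : MomentsClose η w w' m m') : MomentsClose η w' w m' m := fun S ↦ by
  rw [abs_sub_comm]
  exact h S

lemma MomentsClose.trans {η η' : ℝ} {w : κ → ℝ} {w' : κ' → ℝ} {w'' : κ'' → ℝ} {m : ι → κ → ℝ}
    {m' : ι → κ' → ℝ} {m'' : ι → κ'' → ℝ} (h : MomentsClose η w w' m m')
    (h' : MomentsClose η' w' w'' m' m'') : MomentsClose (η + η') w w'' m m'' := fun S ↦
  (abs_sub_le _ _ _).trans (add_le_add (h S) (h' S))

lemma abs_prod_sub_prod_le (S : Finset ι) {a b : ι → ℝ} (ha : ∀ i, a i ∈ Set.Icc (0 : ℝ) 1)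
    (hb : ∀ i, b i ∈ Set.Icc (0 : ℝ) 1) :
    |∏ i ∈ S, a i - ∏ i ∈ S, b i| ≤ ∑ i ∈ S, |a i - b i| := by
  classical
  induction S using Finset.induction_on with
  | empty => simp
  | insert i S hi ih =>
    have hprod : ∏ x ∈ S, a x ∈ Set.Icc (0 : ℝ) 1 := unitInterval.prod_mem fun i _ ↦ ha i
    rw [prod_insert hi, prod_insert hi, sum_insert hi]
    calc |a i * ∏ x ∈ S, a x - b i * ∏ x ∈ S, b x|
        = |(a i - b i) * ∏ x ∈ S, a x + b i * (∏ x ∈ S, a x - ∏ x ∈ S, b x)| := by ring_nf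
      _ ≤ |a i - b i| * ∏ x ∈ S, a x + b i * |∏ x ∈ S, a x - ∏ x ∈ S, b x| := by
        refine (abs_add_le _ _).trans_eq ?_
        rw [abs_mul, abs_mul, abs_of_nonneg hprod.1, abs_of_nonneg (hb i).1]
      _ ≤ |a i - b i| + ∑ i ∈ S, |a i - b i| := add_le_add
        (mul_le_of_le_one_right (abs_nonneg _) hprod.2)
        ((mul_le_of_le_one_left (abs_nonneg _) (hb i).2).trans ih)

lemma momentsClose_of_abs_sub_le [Fintype ι] {w w' : κ → ℝ} {m m' : ι → κ → ℝ} {d e : ℝ}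
    (hw' : w' ∈ stdSimplex ℝ κ) (hm : ∀ i l, m i l ∈ Set.Icc (0 : ℝ) 1)
    (hm' : ∀ i l, m' i l ∈ Set.Icc (0 : ℝ) 1) (hd : ∀ l, |w l - w' l| ≤ d)
    (he : ∀ i l, |m i l - m' i l| ≤ e) :
    MomentsClose (Fintype.card κ * d + Fintype.card ι * e) w w' m m' := by
  intro S
  have hweights : ∑ l, |w l - w' l| * ∏ i ∈ S, m i l ≤ Fintype.card κ * d := by
    refine (sum_le_card_nsmul univ _ d fun l _ ↦ ?_).trans_eq (nsmul_eq_mul _ _)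
    exact (mul_le_of_le_one_right (abs_nonneg _)
      (unitInterval.prod_mem fun i _ ↦ hm i l).2).trans (hd l)
  have hmeans (l : κ) : |∏ i ∈ S, m i l - ∏ i ∈ S, m' i l| ≤ Fintype.card ι * e :=
    calc _ ≤ ∑ i ∈ S, |m i l - m' i l| := abs_prod_sub_prod_le S (hm · l) (hm' · l)
      _ ≤ ∑ i, |m i l - m' i l| :=
        sum_le_univ_sum_of_nonneg fun _ ↦ abs_nonneg _
      _ ≤ Fintype.card ι * e :=
        (sum_le_card_nsmul univ _ e fun i _ ↦ he i l).trans_eq (nsmul_eq_mul _ _)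
  calc |moment w m S - moment w' m' S|
      = |∑ l, ((w l - w' l) * ∏ i ∈ S, m i l +
          w' l * (∏ i ∈ S, m i l - ∏ i ∈ S, m' i l))| := by
        rw [moment, moment, ← sum_sub_distrib]
        ring_nf
    _ ≤ ∑ l, (|w l - w' l| * ∏ i ∈ S, m i l + w' l * (Fintype.card ι * e)) := by
        refine (abs_sum_le_sum_abs _ _).trans (sum_le_sum fun l _ ↦ (abs_add_le _ _).trans ?_)
        rw [abs_mul, abs_mul, abs_of_nonneg (unitInterval.prod_mem fun i _ ↦ hm i l).1,
          abs_of_nonneg (hw'.1 l)]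
        gcongr
        · exact hw'.1 l
        · exact hmeans l
    _ ≤ Fintype.card κ * d + Fintype.card ι * e := by
        rw [sum_add_distrib, ← sum_mul, hw'.2, one_mul]
        gcongr

lemma exists_natCast_near_of_nonneg {x : ℕ → ℝ} (hx : ∀ j, 0 ≤ x j) :
    ∃ a : ℕ → ℕ, (∀ k, ∑ j ∈ range k, a j = ⌊∑ j ∈ range k, x j⌋₊) ∧
      ∀ j, |x j - a j| ≤ 1 := by
  set A : ℕ → ℝ := fun k ↦ ∑ j ∈ range k, x j with hA
  have hA0 (k : ℕ) : 0 ≤ A k := sum_nonneg fun j _ ↦ hx j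
  have hfloor : Monotone fun k ↦ ⌊A k⌋₊ :=
    monotone_nat_of_le_succ fun k ↦ Nat.floor_mono (by simp [hA, sum_range_succ, hx])
  refine ⟨fun j ↦ ⌊A (j + 1)⌋₊ - ⌊A j⌋₊, fun k ↦ ?_, fun j ↦ ?_⟩
  · rw [sum_range_tsub hfloor]
    simp [hA]
  · have hsucc : A (j + 1) = A j + x j := sum_range_succ x j
    rw [Nat.cast_sub (hfloor j.le_succ), abs_le]
    constructor <;> linarith [Nat.floor_le (hA0 j), Nat.lt_floor_add_one (A j),
      Nat.floor_le (hA0 (j + 1)), Nat.lt_floor_add_one (A (j + 1))]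

lemma abs_sub_floor_div_le {x Q : ℝ} (hQ : 0 < Q) (hx : 0 ≤ x) :
    |x - ⌊Q * x⌋₊ / Q| ≤ 1 / Q := by
  rw [sub_div' hQ.ne', abs_div, abs_of_pos hQ, mul_comm x]
  gcongr
  rw [abs_le]
  constructor <;> linarith [Nat.floor_le (mul_nonneg hQ.le hx), Nat.lt_floor_add_one (Q * x)]

lemma floor_div_mem_Icc {x Q : ℝ} (hQ : 0 < Q) (hx : x ∈ Set.Icc (0 : ℝ) 1) :
    (⌊Q * x⌋₊ : ℝ) / Q ∈ Set.Icc (0 : ℝ) 1 := by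
  refine ⟨by positivity, (div_le_one hQ).2 ?_⟩
  exact (Nat.floor_le (mul_nonneg hQ.le hx.1)).trans (mul_le_of_le_one_right hQ.le hx.2)

lemma exists_weights_near {k Q : ℕ} (hQ : 0 < Q) {w : Fin k → ℝ} (hw : w ∈ stdSimplex ℝ (Fin k)) :
    ∃ a : Fin k → ℕ, ∑ j, a j = Q ∧ ∀ j, |w j - a j / Q| ≤ 1 / Q := by
  have hQ' : (0 : ℝ) < Q := Nat.cast_pos.2 hQ
  obtain ⟨a, hsum, ha⟩ := exists_natCast_near_of_nonneg
    (x := fun j ↦ if h : j < k then Q * w ⟨j, h⟩ else 0) fun j ↦ by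
      split_ifs
      · exact mul_nonneg hQ'.le (hw.1 _)
      · exact le_rfl
  refine ⟨fun j ↦ a j, ?_, fun j ↦ ?_⟩
  · simpa [sum_range, ← mul_sum, hw.2] using hsum k
  · have haj : |Q * w j - a j| ≤ 1 := by simpa using ha j
    rw [sub_div' hQ'.ne', abs_div, abs_of_pos hQ', mul_comm (w j)]
    gcongr

lemma exists_code_gridParams_eq {n k Q : ℕ} {a : Fin k → ℕ} {b : Fin n → Fin k → ℕ}
    (ha : ∑ j, a j = Q) (hb : ∀ i j, b i j ≤ Q) :
    ∃ c < numCodes Q n k, IsModelCode Q k c ∧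
      gridParams n k Q (entry Q k c) =
        (fun j ↦ (a j : ℝ) / Q, fun i j ↦ (b i j : ℝ) / Q) := by
  obtain ⟨c, hc, h⟩ := exists_entry_eq (Q := Q) (T := (Fin.cons a b : Fin (n + 1) → Fin k → ℕ))
    (Fin.cases (fun j ↦ ha ▸ single_le_sum (fun _ _ ↦ Nat.zero_le _) (mem_univ j)) hb)
  have hweight (j : Fin k) : entry Q k c 0 j = a j := h 0 j
  have hmean (i : Fin n) (j : Fin k) : entry Q k c (i + 1) j = b i j := h i.succ j
  refine ⟨c, hc, ?_, by simp only [gridParams, hweight, hmean]⟩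
  simp only [IsModelCode, sum_range, hweight, ha]

lemma exists_code_momentsClose {n k Q : ℕ} (hQ : 0 < Q) {θ : Params n k} (hθ : θ ∈ models n k) :
    ∃ c < numCodes Q n k, IsModelCode Q k c ∧ MomentsClose ((k + n) / Q)
      (gridParams n k Q (entry Q k c)).1 θ.1 (gridParams n k Q (entry Q k c)).2 θ.2 := by
  have hQ' : (0 : ℝ) < Q := Nat.cast_pos.2 hQ
  obtain ⟨a, ha, hnear⟩ := exists_weights_near hQ hθ.1
  obtain ⟨c, hc, hmodel, heq⟩ := exists_code_gridParams_eq (b := fun i j ↦ ⌊Q * θ.2 i j⌋₊) ha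
    fun i j ↦ Nat.floor_le_of_le (mul_le_of_le_one_right hQ'.le (hθ.2 i j).2)
  refine ⟨c, hc, hmodel, ?_⟩
  rw [heq]
  convert momentsClose_of_abs_sub_le hθ.1 (fun i j ↦ floor_div_mem_Icc hQ' (hθ.2 i j)) hθ.2
    (fun j ↦ (abs_sub_comm _ _).trans_le (hnear j))
    fun i j ↦ (abs_sub_comm _ _).trans_le (abs_sub_floor_div_le hQ' (hθ.2 i j).1) using 1
  rw [Fintype.card_fin, Fintype.card_fin]
  ring

end Rounding

section Digitization

variable {n k N : ℕ} {X : Fin N → Fin n → ℝ}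

lemma length_digitize (X : Fin N → Fin n → ℝ) : (digitize X).length = N := by simp [digitize]

lemma uniformWeight_mem_stdSimplex (hN : 0 < N) : uniformWeight N ∈ stdSimplex ℝ (Fin N) :=
  ⟨fun _ ↦ by simp only [uniformWeight]; positivity, by simp [uniformWeight, hN.ne']⟩

lemma dataValue_digitize (Q : ℕ) (X : Fin N → Fin n → ℝ) (i : Fin n) (r : Fin N) :
    dataValue n Q (digitize X) i (r.cast (length_digitize X).symm) =
      (⌊2 ^ N * X r i⌋₊ : ℝ) / Q := by
  rw [dataValue, Fin.val_cast]
  simp [digitize]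

lemma moment_dataValue_digitize (Q : ℕ) (X : Fin N → Fin n → ℝ) (S : Finset (Fin n)) :
    moment (uniformWeight (digitize X).length) (dataValue n Q (digitize X)) S =
      moment (uniformWeight N) (fun i r ↦ (⌊2 ^ N * X r i⌋₊ : ℝ) / Q) S :=
  (Fintype.sum_equiv (finCongr (length_digitize X)).symm _ _ fun r ↦ by
    simp only [finCongr_symm, finCongr_apply, dataValue_digitize, uniformWeight,
      length_digitize]).symm

lemma momentsClose_digitize (hN : 0 < N) (hX : ∀ r i, X r i ∈ Set.Icc (0 : ℝ) 1) :
    MomentsClose (n / 2 ^ N) (uniformWeight N) (uniformWeight (digitize X).length)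
      (fun i r ↦ X r i) (dataValue n (2 ^ N) (digitize X)) := by
  intro S
  rw [moment_dataValue_digitize, Nat.cast_pow, Nat.cast_ofNat]
  have hQ : (0 : ℝ) < 2 ^ N := by positivity
  have h := momentsClose_of_abs_sub_le (w := uniformWeight N) (d := 0)
    (uniformWeight_mem_stdSimplex hN)
    (fun i r ↦ hX r i) (fun i r ↦ floor_div_mem_Icc hQ (hX r i)) (fun _ ↦ by simp)
    (fun i r ↦ abs_sub_floor_div_le hQ (hX r i).1) S
  rwa [mul_zero, zero_add, Fintype.card_fin, mul_one_div] at h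

lemma readParams_estimator_mem_models (h : (models (2 * k - 1) k).Nonempty) (D : List (List ℕ)) :
    readParams (2 * k - 1) k (estimator (k, D)) ∈ models (2 * k - 1) k := by
  obtain ⟨θ, hθ⟩ := h
  obtain ⟨c, hc, hmodel, -⟩ := exists_code_momentsClose (Q := 2 ^ D.length) (by positivity) hθ
  rw [readParams_estimator]
  exact gridParams_mem_models (by positivity) (isBestCode_bestCode hc hmodel).1 fun _ _ ↦
    entry_le ..

theorem momentsClose_estimator (hk : 1 ≤ k) (hN : 0 < N) {θ : Params (2 * k - 1) k}
    (hθ : θ ∈ models (2 * k - 1) k) {X : Fin N → Fin (2 * k - 1) → ℝ}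
    (hX : ∀ r i, X r i ∈ Set.Icc (0 : ℝ) 1) {h : ℝ}
    (hemp : MomentsClose h θ.1 (uniformWeight N) θ.2 fun i r ↦ X r i) :
    MomentsClose (4 ^ k * (h + 4 * k / 2 ^ N)) θ.1
      (readParams (2 * k - 1) k (estimator (k, digitize X))).1 θ.2
      (readParams (2 * k - 1) k (estimator (k, digitize X))).2 := by
  have hdata := hemp.trans (momentsClose_digitize hN hX)
  obtain ⟨c, hc, hmodel, hcode⟩ := exists_code_momentsClose (Q := 2 ^ N) (by positivity) hθ
  have hD : digitize X ≠ [] := List.length_pos_iff.1 (by rwa [length_digitize])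
  have hbest := momentsClose_bestCode (by positivity) hD hc hmodel (hcode.trans hdata)
  rw [readParams_estimator, length_digitize]
  refine fun S ↦ ((hdata.trans hbest.symm) S).trans ?_
  have hn : ((2 * k - 1 : ℕ) : ℝ) ≤ 2 * k := by exact_mod_cast Nat.sub_le _ _
  have hpow : (4 : ℝ) ^ k = 2 * 2 ^ (2 * k - 1) := by
    rw [← pow_succ', show 2 * k - 1 + 1 = 2 * k by omega, pow_mul]
    norm_num
  have hone : (1 : ℝ) ≤ 2 ^ (2 * k - 1) := one_le_pow₀ one_le_two
  have hh := hemp.nonneg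
  push_cast
  calc h + (2 * k - 1 : ℕ) / 2 ^ N +
        2 ^ (2 * k - 1) * ((k + (2 * k - 1 : ℕ)) / 2 ^ N + (h + (2 * k - 1 : ℕ) / 2 ^ N))
      ≤ 2 ^ (2 * k - 1) * (h + 2 * k / 2 ^ N) +
        2 ^ (2 * k - 1) * ((k + 2 * k) / 2 ^ N + (h + 2 * k / 2 ^ N)) := by
        gcongr
        exact (by gcongr : _ ≤ h + 2 * k / 2 ^ N).trans
          (le_mul_of_one_le_left (by positivity) hone)
    _ = 2 * 2 ^ (2 * k - 1) * (h + (7 / 2) * k / 2 ^ N) := by ring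
    _ ≤ 4 ^ k * (h + 4 * k / 2 ^ N) := by
        rw [hpow]
        gcongr
        norm_num

end Digitization

section Hoeffding

open MeasureTheory ProbabilityTheory

lemma measureReal_abs_ge_le_of_hasSubgaussianMGF {Ω : Type*} {mΩ : MeasurableSpace Ω}
    {μ : Measure Ω} [IsFiniteMeasure μ] {X : Ω → ℝ} {c : NNReal} (hX : HasSubgaussianMGF X c μ)
    {t : ℝ} (ht : 0 ≤ t) : μ.real {ω | t ≤ |X ω|} ≤ 2 * Real.exp (-t ^ 2 / (2 * c)) := by
  have hsubset : {ω | t ≤ |X ω|} ⊆ {ω | t ≤ X ω} ∪ {ω | t ≤ (-X) ω} :=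
    fun ω hω ↦ le_abs.1 (show t ≤ |X ω| from hω)
  calc μ.real {ω | t ≤ |X ω|}
      ≤ μ.real {ω | t ≤ X ω} + μ.real {ω | t ≤ (-X) ω} :=
        (measureReal_mono hsubset).trans (measureReal_union_le _ _)
    _ ≤ 2 * Real.exp (-t ^ 2 / (2 * c)) := by
        rw [two_mul]
        exact add_le_add (hX.measure_ge_le ht) (hX.neg.measure_ge_le ht)

variable {Ω ι : Type*} [MeasurableSpace Ω] [Fintype ι] {P : Measure Ω} [IsProbabilityMeasure P]

lemma hasSubgaussianMGF_sum_sub_integral {f : Ω → ℝ} (hf : AEMeasurable f P)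
    (h01 : ∀ᵐ x ∂P, f x ∈ Set.Icc (0 : ℝ) 1) :
    HasSubgaussianMGF (fun X : ι → Ω ↦ ∑ s, (f (X s) - ∫ x, f x ∂P)) (Fintype.card ι / 4)
      (Measure.pi fun _ ↦ P) := by
  have hmp (s : ι) : MeasurePreserving (Function.eval s) (Measure.pi fun _ ↦ P) P :=
    measurePreserving_eval (fun _ ↦ P) s
  have hsub : HasSubgaussianMGF (fun x ↦ f x - ∫ x, f x ∂P) (1 / 4) P := by
    convert hasSubgaussianMGF_of_mem_Icc hf h01 using 1
    norm_num
  have hind : iIndepFun (fun s X ↦ f (X s) - ∫ x, f x ∂P) (Measure.pi fun _ : ι ↦ P) :=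
    iIndepFun_pi fun _ ↦ hf.sub_const _
  have hsub_eval (s : ι) : HasSubgaussianMGF (fun X ↦ f (X s) - ∫ x, f x ∂P) (1 / 4)
      (Measure.pi fun _ ↦ P) :=
    HasSubgaussianMGF.of_map (X := fun x ↦ f x - ∫ x, f x ∂P)
      (hmp s).measurable.aemeasurable (by rwa [(hmp s).map_eq])
  convert HasSubgaussianMGF.sum_of_iIndepFun hind (s := univ) fun s _ ↦ hsub_eval s using 1
  simp [div_eq_mul_inv]

theorem measureReal_pi_abs_sum_sub_integral_ge_le {f : Ω → ℝ} (hf : AEMeasurable f P)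
    (h01 : ∀ᵐ x ∂P, f x ∈ Set.Icc (0 : ℝ) 1) {t : ℝ} (ht : 0 ≤ t) :
    (Measure.pi fun _ : ι ↦ P).real {X | t ≤ |∑ s, (f (X s) - ∫ x, f x ∂P)|} ≤
      2 * Real.exp (-(2 * t ^ 2 / Fintype.card ι)) := by
  convert measureReal_abs_ge_le_of_hasSubgaussianMGF
    (hasSubgaussianMGF_sum_sub_integral (ι := ι) hf h01) ht using 3
  push_cast
  ring

end Hoeffding

section MixtureLaw

open MeasureTheory

variable {n k N : ℕ} {θ : Params n k} {P : Measure (Fin n → ℝ)}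

lemma IsMixtureLaw.isProbabilityMeasure (h : IsMixtureLaw θ P) (hθ : θ.1 ∈ stdSimplex ℝ (Fin k)) :
    IsProbabilityMeasure P := by
  obtain ⟨ν, hν, -, -, rfl⟩ := h
  constructor
  simp only [Measure.finsetSum_apply, Measure.smul_apply, measure_univ, smul_eq_mul, mul_one]
  rw [← ENNReal.ofReal_sum_of_nonneg fun j _ ↦ hθ.1 j, hθ.2, ENNReal.ofReal_one]

lemma IsMixtureLaw.isProbabilityMeasure_sampleLaw (h : IsMixtureLaw θ P)
    (hθ : θ.1 ∈ stdSimplex ℝ (Fin k)) : IsProbabilityMeasure (sampleLaw N P) := by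
  have := h.isProbabilityMeasure hθ
  unfold sampleLaw
  infer_instance

lemma ae_pi_forall_mem {ι Ω : Type*} [Fintype ι] [MeasurableSpace Ω] {ν : ι → Measure Ω}
    [∀ i, IsProbabilityMeasure (ν i)] {s : Set Ω} (h : ∀ i, ∀ᵐ x ∂ν i, x ∈ s) :
    ∀ᵐ x ∂Measure.pi ν, ∀ i, x i ∈ s :=
  ae_all_iff.2 fun i ↦ (measurePreserving_eval ν i).quasiMeasurePreserving.ae (h i)

lemma IsMixtureLaw.ae_mem_Icc (h : IsMixtureLaw θ P) :
    ∀ᵐ x ∂P, ∀ i, x i ∈ Set.Icc (0 : ℝ) 1 := by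
  obtain ⟨ν, hν, h01, -, rfl⟩ := h
  rw [ae_finsetSum_measure_iff]
  exact fun j _ ↦ Measure.ae_smul_measure (ae_pi_forall_mem fun i ↦ h01 i j) _

lemma integral_pi_prod_finset (ν : Fin n → Measure ℝ) [∀ i, IsProbabilityMeasure (ν i)]
    (S : Finset (Fin n)) : ∫ x, ∏ i ∈ S, x i ∂Measure.pi ν = ∏ i ∈ S, ∫ x, x ∂ν i := by
  have h := integral_fintype_prod_eq_prod (𝕜 := ℝ) (fun i x ↦ if i ∈ S then x else 1) (μ := ν)
  simp only [prod_ite_mem, univ_inter] at h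
  rw [h, ← prod_subset (subset_univ S) fun i _ hi ↦ by simp [hi]]
  exact prod_congr rfl fun i hi ↦ by simp [hi]

lemma IsMixtureLaw.integral_prod (h : IsMixtureLaw θ P) (hθ : ∀ j, 0 ≤ θ.1 j)
    (S : Finset (Fin n)) : ∫ x, ∏ i ∈ S, x i ∂P = moment θ.1 θ.2 S := by
  obtain ⟨ν, hν, h01, hmean, rfl⟩ := h
  have hint (j : Fin k) : Integrable (fun x : Fin n → ℝ ↦ ∏ i ∈ S, x i)
      (Measure.pi fun i ↦ ν i j) :=
    .of_mem_Icc 0 1 (by fun_prop)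
      ((ae_pi_forall_mem fun i ↦ h01 i j).mono fun x hx ↦ unitInterval.prod_mem fun i _ ↦ hx i)
  rw [integral_finsetSum_measure fun j _ ↦ (hint j).smul_measure ENNReal.ofReal_ne_top]
  refine sum_congr rfl fun j _ ↦ ?_
  rw [integral_smul_measure, ENNReal.toReal_ofReal (hθ j), smul_eq_mul, integral_pi_prod_finset]
  simp only [hmean]

lemma moment_uniformWeight_sub (hN : 0 < N) (X : Fin N → Fin n → ℝ) (S : Finset (Fin n)) (c : ℝ) :
    moment (uniformWeight N) (fun i r ↦ X r i) S - c = (∑ r, (∏ i ∈ S, X r i - c)) / N := by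
  simp only [moment, uniformWeight, ← mul_sum, sum_sub_distrib, sum_const, card_univ,
    Fintype.card_fin, nsmul_eq_mul]
  field_simp

lemma IsMixtureLaw.sampleLaw_real_abs_moment_sub_gt_le (hP : IsMixtureLaw θ P)
    (hθ : θ.1 ∈ stdSimplex ℝ (Fin k)) (hN : 0 < N) {h : ℝ} (hh : 0 ≤ h) (S : Finset (Fin n)) :
    (sampleLaw N P).real {X | h < |moment θ.1 θ.2 S -
      moment (uniformWeight N) (fun i r ↦ X r i) S|} ≤ 2 * Real.exp (-(2 * N * h ^ 2)) := by
  have := hP.isProbabilityMeasure hθ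
  have hN' : (0 : ℝ) < N := Nat.cast_pos.2 hN
  have hoeffding := measureReal_pi_abs_sum_sub_integral_ge_le (ι := Fin N) (P := P)
    (f := fun x ↦ ∏ i ∈ S, x i) (by fun_prop)
    (hP.ae_mem_Icc.mono fun x hx ↦ unitInterval.prod_mem fun i _ ↦ hx i)
    (mul_nonneg hN'.le hh)
  rw [hP.integral_prod hθ.1, Fintype.card_fin,
    show 2 * (N * h) ^ 2 / (N : ℝ) = 2 * N * h ^ 2 by field_simp] at hoeffding
  have := hP.isProbabilityMeasure_sampleLaw (N := N) hθ
  refine (measureReal_mono fun X hX ↦ ?_).trans hoeffding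
  rw [Set.mem_ofPred_eq, abs_sub_comm, moment_uniformWeight_sub hN, abs_div,
    abs_of_pos hN', lt_div_iff₀ hN', mul_comm] at hX
  exact hX.le

theorem IsMixtureLaw.le_sampleLaw_real_momentsClose (hP : IsMixtureLaw θ P)
    (hθ : θ.1 ∈ stdSimplex ℝ (Fin k)) (hN : 0 < N) {h : ℝ} (hh : 0 ≤ h) :
    1 - 2 ^ n * (2 * Real.exp (-(2 * N * h ^ 2))) ≤ (sampleLaw N P).real
      {X | (∀ r i, X r i ∈ Set.Icc (0 : ℝ) 1) ∧
        MomentsClose h θ.1 (uniformWeight N) θ.2 fun i r ↦ X r i} := by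
  have := hP.isProbabilityMeasure hθ
  have := hP.isProbabilityMeasure_sampleLaw (N := N) hθ
  let bad (S : Finset (Fin n)) : Set (Fin N → Fin n → ℝ) :=
    {X | h < |moment θ.1 θ.2 S - moment (uniformWeight N) (fun i r ↦ X r i) S|}
  let outside : Set (Fin N → Fin n → ℝ) := {X | ¬∀ r i, X r i ∈ Set.Icc (0 : ℝ) 1}
  have hbad : (sampleLaw N P).real (⋃ S, bad S) ≤ 2 ^ n * (2 * Real.exp (-(2 * N * h ^ 2))) := by
    refine (measureReal_iUnion_fintype_le _).trans ((sum_le_card_nsmul univ _ _ fun S _ ↦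
      hP.sampleLaw_real_abs_moment_sub_gt_le hθ hN hh S).trans_eq ?_)
    simp
  have houtside : (sampleLaw N P).real outside = 0 :=
    (measureReal_eq_zero_iff).2 <| ae_iff.1 <|
      ae_pi_forall_mem (s := {x : Fin n → ℝ | ∀ i, x i ∈ Set.Icc (0 : ℝ) 1}) fun _ ↦ hP.ae_mem_Icc
  set good : Set (Fin N → Fin n → ℝ) := {X | (∀ r i, X r i ∈ Set.Icc (0 : ℝ) 1) ∧
    MomentsClose h θ.1 (uniformWeight N) θ.2 fun i r ↦ X r i}
  have hcover : (Set.univ : Set (Fin N → Fin n → ℝ)) ⊆ good ∪ (outside ∪ ⋃ S, bad S) := by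
    intro X _
    by_cases hX : ∀ r i, X r i ∈ Set.Icc (0 : ℝ) 1
    · by_cases hclose : MomentsClose h θ.1 (uniformWeight N) θ.2 fun i r ↦ X r i
      · exact .inl ⟨hX, hclose⟩
      · obtain ⟨S, hS⟩ := not_forall.1 hclose
        exact .inr (.inr (Set.mem_iUnion.2 ⟨S, not_le.1 hS⟩))
    · exact .inr (.inl hX)
  have htotal : 1 ≤ (sampleLaw N P).real good +
      ((sampleLaw N P).real outside + (sampleLaw N P).real (⋃ S, bad S)) :=
    calc 1 = (sampleLaw N P).real Set.univ := probReal_univ.symm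
      _ ≤ _ := (measureReal_mono hcover).trans <| (measureReal_union_le _ _).trans <|
        add_le_add_right (measureReal_union_le _ _) _
  linarith

end MixtureLaw

section SampleComplexity

variable {k N : ℕ} {ζ p ε δ : ℝ}

lemma two_mul_le_one_of_three_le (hk : 3 ≤ k) {x : Fin k → ℝ} (hx : ∀ j, x j ∈ Set.Icc (0 : ℝ) 1)
    (hsep : ∀ j j', j ≠ j' → ζ ≤ |x j - x j'|) : 2 * ζ ≤ 1 := by
  have h₀₁ := hsep ⟨0, by omega⟩ ⟨1, by omega⟩ (by simp)
  have h₀₂ := hsep ⟨0, by omega⟩ ⟨2, by omega⟩ (by simp)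
  have h₁₂ := hsep ⟨1, by omega⟩ ⟨2, by omega⟩ (by simp)
  have hx₀ := Set.mem_Icc.1 (hx ⟨0, by omega⟩)
  have hx₁ := Set.mem_Icc.1 (hx ⟨1, by omega⟩)
  have hx₂ := Set.mem_Icc.1 (hx ⟨2, by omega⟩)
  grind

lemma two_pow_le_of_separated (hζ : 0 < ζ) (hζ1 : ζ ≤ 1) {x : Fin k → ℝ}
    (hx : ∀ j, x j ∈ Set.Icc (0 : ℝ) 1) (hsep : ∀ j j', j ≠ j' → ζ ≤ |x j - x j'|) :
    (2 : ℝ) ^ k ≤ 4 * (1 / ζ) ^ k := by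
  rcases Nat.lt_or_ge k 3 with hk | hk
  · calc (2 : ℝ) ^ k ≤ 2 ^ 2 := pow_le_pow_right₀ one_le_two (by omega)
      _ = 4 * 1 := by norm_num
      _ ≤ 4 * (1 / ζ) ^ k := by gcongr; exact one_le_pow₀ (one_le_one_div hζ hζ1)
  · have h2 : 2 ≤ 1 / ζ := (le_div_iff₀ hζ).2 (two_mul_le_one_of_three_le hk hx hsep)
    calc (2 : ℝ) ^ k ≤ (1 / ζ) ^ k := by gcongr
      _ ≤ 4 * (1 / ζ) ^ k := le_mul_of_one_le_left (by positivity) (by norm_num)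

lemma stabilityConst_sq_le {C : ℕ} (hC : 2 ^ 46 ≤ C) (hζ : 0 < ζ) (hζ1 : ζ ≤ 1) (hp : 0 < p)
    (hp1 : p ≤ 1) (h2 : (2 : ℝ) ^ k ≤ 4 * (1 / ζ) ^ k) :
    24 * k * 16 ^ k * stabilityConst k ζ p ^ 2 ≤
      C * (1 / ζ) ^ (C * k) * (1 / p) ^ C := by
  have hz : 1 ≤ 1 / ζ := one_le_one_div hζ hζ1
  have hq : 1 ≤ 1 / p := one_le_one_div hp hp1
  have hk : (k : ℝ) ≤ 2 ^ k := mod_cast Nat.lt_two_pow_self.le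
  have h16 : (16 : ℝ) ^ k = (2 ^ k) ^ 4 := by rw [← pow_right_comm]; norm_num
  calc 24 * k * 16 ^ k * stabilityConst k ζ p ^ 2
      = 60000 * (k : ℝ) ^ 3 * ((2 : ℝ) ^ k) ^ 12 * ((1 / ζ) ^ k) ^ 8 * (1 / p) ^ 4 := by
        rw [h16, stabilityConst, div_eq_mul_one_div 2 ζ, div_eq_mul_one_div _ (p ^ 2),
          ← one_div_pow]
        ring
    _ ≤ 60000 * ((2 : ℝ) ^ k) ^ 3 * ((2 : ℝ) ^ k) ^ 12 * ((1 / ζ) ^ k) ^ 8 * (1 / p) ^ 4 := by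
        gcongr
    _ = 60000 * ((2 : ℝ) ^ k) ^ 15 * ((1 / ζ) ^ k) ^ 8 * (1 / p) ^ 4 := by ring
    _ ≤ 60000 * (4 * (1 / ζ) ^ k) ^ 15 * ((1 / ζ) ^ k) ^ 8 * (1 / p) ^ 4 := by gcongr
    _ = (60000 * 4 ^ 15) * (1 / ζ) ^ (23 * k) * (1 / p) ^ 4 := by ring
    _ ≤ C * (1 / ζ) ^ (C * k) * (1 / p) ^ C := by
        have hC' : (2 ^ 46 : ℝ) ≤ C := mod_cast hC
        gcongr
        · linarith
        · omega
        · omega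

lemma log_two_le_log_one_div (hδ : 0 < δ) (hδ2 : δ ≤ 1 / 2) : Real.log 2 ≤ Real.log (1 / δ) :=
  Real.log_le_log two_pos ((le_div_iff₀ hδ).2 (by linarith))

lemma two_pow_mul_exp_neg_le (hk : 1 ≤ k) (hδ : 0 < δ) (hδ2 : δ ≤ 1 / 2) {t : ℝ}
    (ht : 3 * k * Real.log (1 / δ) ≤ t) :
    2 ^ (2 * k - 1) * (2 * Real.exp (-t)) ≤ δ := by
  have hlog : 2 * k * Real.log 2 ≤ 2 * k * Real.log (1 / δ) :=
    mul_le_mul_of_nonneg_left (log_two_le_log_one_div hδ hδ2) (by positivity)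
  have hlog_nonneg : 0 ≤ Real.log (1 / δ) :=
    (Real.log_nonneg one_le_two).trans (log_two_le_log_one_div hδ hδ2)
  have hlog_le : Real.log (1 / δ) ≤ k * Real.log (1 / δ) :=
    le_mul_of_one_le_left hlog_nonneg (Nat.one_le_cast.2 hk)
  calc (2 : ℝ) ^ (2 * k - 1) * (2 * Real.exp (-t)) = 2 ^ (2 * k) * Real.exp (-t) := by
        rw [← mul_assoc, pow_sub_one_mul (by omega)]
    _ = Real.exp (2 * k * Real.log 2 - t) := by
        rw [sub_eq_add_neg, Real.exp_add, ← Nat.cast_ofNat (R := ℝ), ← Nat.cast_mul,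
          Nat.cast_ofNat, Real.exp_nat_mul, Real.exp_log two_pos]
    _ ≤ Real.exp (-Real.log (1 / δ)) := Real.exp_le_exp.2 (by linarith)
    _ = δ := by rw [one_div, Real.log_inv, neg_neg, Real.exp_log hδ]

lemma one_le_stabilityConst (hk : 1 ≤ k) (hζ : 0 < ζ) (hζ1 : ζ ≤ 1) (hp : 0 < p) (hp1 : p ≤ 1) :
    1 ≤ stabilityConst k ζ p := by
  have hk' : (1 : ℝ) ≤ k := Nat.one_le_cast.2 hk
  have hζpow : 1 ≤ (2 / ζ) ^ (4 * k) := one_le_pow₀ ((one_le_div hζ).2 (by linarith))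
  have hppow : p ^ 2 ≤ 1 := pow_le_one₀ hp.le hp1
  rw [stabilityConst, one_le_div (by positivity)]
  calc p ^ 2 ≤ 50 * 1 * 1 := by linarith
    _ ≤ 50 * k * (2 / ζ) ^ (4 * k) := by gcongr

lemma discretization_error_le (hk : 1 ≤ k) {K : ℝ} (hK : 1 ≤ K) (hε : 0 < ε) (hε1 : ε ≤ 1)
    (hN : 12 * k * 16 ^ k * K ^ 2 ≤ N * ε ^ 2) :
    4 ^ k * (4 * k / 2 ^ N) ≤ ε / (4 * K) := by
  have h2N : (N : ℝ) ≤ 2 ^ N := mod_cast Nat.lt_two_pow_self.le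
  have h4 : (4 : ℝ) ≤ 4 ^ k := le_self_pow₀ (by norm_num) (by omega)
  have h16 : (16 : ℝ) ^ k = 4 ^ k * 4 ^ k := by rw [← mul_pow]; norm_num
  have hbound : 16 * (4 ^ k * k * K) ≤ ε * 2 ^ N :=
    calc 16 * (4 ^ k * k * K) ≤ 3 * 4 ^ k * 4 * (4 ^ k * k * K) * 1 := by
          nlinarith [show 0 ≤ 4 ^ k * k * K by positivity]
      _ ≤ 3 * 4 ^ k * 4 * (4 ^ k * k * K) * K := by gcongr
      _ = 12 * k * 16 ^ k * K ^ 2 := by rw [h16]; ring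
      _ ≤ N * ε ^ 2 := hN
      _ = N * (ε * ε) := by ring
      _ ≤ 2 ^ N * (ε * 1) := by gcongr
      _ = ε * 2 ^ N := by ring
  rw [mul_div_assoc', div_le_div_iff₀ (by positivity) (by positivity)]
  linarith

end SampleComplexity

section Accuracy

variable {k N : ℕ} {ζ p ε δ : ℝ} {θ : Params (2 * k - 1) k}
  {P : MeasureTheory.Measure (Fin (2 * k - 1) → ℝ)}

lemma le_one_of_mem_separatedModels (hk : 1 ≤ k) (hθ : θ ∈ separatedModels (2 * k - 1) k ζ p) :
    p ≤ 1 :=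
  (hθ.2.1 ⟨0, hk⟩).trans <| (single_le_sum (fun j _ ↦ hθ.1.1.1 j) (mem_univ _)).trans_eq hθ.1.1.2

lemma le_mul_sq_of_mem_separatedModels {C : ℕ} (hC : 2 ^ 46 ≤ C) (hk : 1 ≤ k) (hζ : 0 < ζ)
    (hζ1 : ζ ≤ 1) (hp : 0 < p) (hε : 0 < ε) (hδ : 0 < δ) (hδ2 : δ ≤ 1 / 2)
    (hN : C * (1 / ζ) ^ (C * k) * (1 / p) ^ C * (1 / ε) ^ 2 * Real.log (1 / δ) ≤ N)
    (hθ : θ ∈ separatedModels (2 * k - 1) k ζ p) :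
    24 * k * 16 ^ k * stabilityConst k ζ p ^ 2 * Real.log (1 / δ) ≤ N * ε ^ 2 := by
  have hlog : 0 ≤ Real.log (1 / δ) :=
    (Real.log_nonneg one_le_two).trans (log_two_le_log_one_div hδ hδ2)
  have hK := stabilityConst_sq_le hC hζ hζ1 hp (le_one_of_mem_separatedModels hk hθ)
    (two_pow_le_of_separated hζ hζ1 (hθ.1.2 ⟨0, by omega⟩) (hθ.2.2 ⟨0, by omega⟩))
  calc 24 * k * 16 ^ k * stabilityConst k ζ p ^ 2 * Real.log (1 / δ)
      = 24 * k * 16 ^ k * stabilityConst k ζ p ^ 2 * (1 / ε) ^ 2 * Real.log (1 / δ) * ε ^ 2 := by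
        field_simp
    _ ≤ N * ε ^ 2 := by
        gcongr
        refine le_trans ?_ hN
        gcongr

theorem modelDist_estimator_le (hk : 1 ≤ k) (hN : 0 < N) (hζ : 0 < ζ) (hζ1 : ζ ≤ 1) (hp : 0 < p)
    (hθ : θ ∈ separatedModels (2 * k - 1) k ζ p) {X : Fin N → Fin (2 * k - 1) → ℝ}
    (hX : ∀ r i, X r i ∈ Set.Icc (0 : ℝ) 1) {h η : ℝ}
    (hemp : MomentsClose h θ.1 (uniformWeight N) θ.2 fun i r ↦ X r i)
    (hh : 4 ^ k * (h + 4 * k / 2 ^ N) ≤ η) (hη : stabilityConst k ζ p * η ≤ 1) :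
    modelDist θ (readParams (2 * k - 1) k (estimator (k, digitize X))) ≤
      stabilityConst k ζ p * η :=
  modelDist_le_of_momentsClose hk le_rfl hζ hζ1 hp hθ
    (readParams_estimator_mem_models ⟨θ, hθ.1⟩ _)
    (fun S ↦ (momentsClose_estimator hk hN hθ.1 hX hemp S).trans hh) hη

theorem le_sampleLaw_real_modelDist_estimator_lt (hk : 1 ≤ k) (hζ : 0 < ζ) (hζ1 : ζ ≤ 1)
    (hp : 0 < p) (hε : 0 < ε) (hε1 : ε ≤ 1) (hδ : 0 < δ) (hδ2 : δ ≤ 1 / 2)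
    (hN : 24 * k * 16 ^ k * stabilityConst k ζ p ^ 2 * Real.log (1 / δ) ≤ N * ε ^ 2)
    (hθ : θ ∈ separatedModels (2 * k - 1) k ζ p) (hP : IsMixtureLaw θ P) :
    1 - δ ≤ (sampleLaw N P).real
      {X | modelDist θ (readParams (2 * k - 1) k (estimator (k, digitize X))) < ε} := by
  set K := stabilityConst k ζ p
  have hK : 1 ≤ K := one_le_stabilityConst hk hζ hζ1 hp (le_one_of_mem_separatedModels hk hθ)
  have hlog : 1 / 2 ≤ Real.log (1 / δ) := by
    linarith [Real.log_two_gt_d9, log_two_le_log_one_div hδ hδ2]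
  have hN' : 12 * k * 16 ^ k * K ^ 2 ≤ N * ε ^ 2 :=
    calc 12 * k * 16 ^ k * K ^ 2 = 24 * k * 16 ^ k * K ^ 2 * (1 / 2) := by ring
      _ ≤ _ := by gcongr
      _ ≤ _ := hN
  have hNpos : 0 < N := by
    have : 0 < N * ε ^ 2 := hN'.trans_lt' (by positivity)
    exact_mod_cast pos_of_mul_pos_left this (by positivity)
  set h : ℝ := ε / (4 * K) / 4 ^ k with hh
  have hdisc : 4 ^ k * (h + 4 * k / 2 ^ N) ≤ ε / (2 * K) := by
    have := discretization_error_le hk hK hε hε1 hN'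
    rw [mul_add, hh, mul_div_cancel₀ _ (by positivity)]
    calc ε / (4 * K) + _ ≤ ε / (4 * K) + ε / (4 * K) := by gcongr
      _ = ε / (2 * K) := by field_simp; norm_num
  have hKη : K * (ε / (2 * K)) = ε / 2 := by field_simp
  have hfail : 2 ^ (2 * k - 1) * (2 * Real.exp (-(2 * N * h ^ 2))) ≤ δ := by
    refine two_pow_mul_exp_neg_le hk hδ hδ2 ?_
    have h16 : (16 : ℝ) ^ k = 4 ^ k * 4 ^ k := by rw [← mul_pow]; norm_num
    have : 2 * N * h ^ 2 = N * ε ^ 2 / (8 * 16 ^ k * K ^ 2) := by rw [hh, h16]; field_simp; norm_num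
    rw [this, le_div_iff₀ (by positivity)]
    linarith
  have := hP.isProbabilityMeasure_sampleLaw (N := N) hθ.1.1
  calc 1 - δ ≤ 1 - 2 ^ (2 * k - 1) * (2 * Real.exp (-(2 * N * h ^ 2))) := by gcongr
    _ ≤ _ := hP.le_sampleLaw_real_momentsClose hθ.1.1 hNpos (by positivity)
    _ ≤ _ := MeasureTheory.measureReal_mono fun X ⟨hX, hemp⟩ ↦
      (modelDist_estimator_le hk hNpos hζ hζ1 hp hθ hX hemp hdisc (by linarith)).trans_lt
        (by linarith)

end Accuracy

end MixProd

theorem corollary3p2 :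
    ∃ (C : ℕ) (alg : ℕ × List (List ℕ) → ℕ × List ℕ × List (List ℕ)),
      Computable alg ∧
      ∀ (k : ℕ) (ζ πmin ε δ : ℝ), 1 ≤ k → 0 < ζ → ζ ≤ 1 → 0 < πmin → 0 < ε →
        0 < δ → δ ≤ 1 / 2 →
      ∀ N : ℕ,
        (C : ℝ) * (1 / ζ) ^ (C * k) * (1 / πmin) ^ C * (1 / ε) ^ 2 * Real.log (1 / δ) ≤ (N : ℝ) →
      ∀ θ ∈ MixProd.separatedModels (2 * k - 1) k ζ πmin,
      ∀ P : MeasureTheory.Measure (Fin (2 * k - 1) → ℝ), MixProd.IsMixtureLaw θ P →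
        1 - δ ≤ (MixProd.sampleLaw N P).real
          {X | MixProd.readParams (2 * k - 1) k (alg (k, MixProd.digitize X)) ∈
                MixProd.models (2 * k - 1) k ∧
              MixProd.modelDist θ
                (MixProd.readParams (2 * k - 1) k (alg (k, MixProd.digitize X))) < ε} := by
  refine ⟨2 ^ 46, MixProd.estimator, MixProd.primrec_estimator.to_comp, ?_⟩
  intro k ζ πmin ε δ hk hζ hζ1 hπ hε hδ hδ2 N hN θ hθ P hP
  have hmodel (X : Fin N → Fin (2 * k - 1) → ℝ) := MixProd.readParams_estimator_mem_models
    ⟨θ, hθ.1⟩ (MixProd.digitize X)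
  simp only [hmodel, true_and]
  rcases lt_or_ge 1 ε with hε1 | hε1
  · have : NeZero k := ⟨by omega⟩
    have : NeZero (2 * k - 1) := ⟨by omega⟩
    have hclose (X : Fin N → Fin (2 * k - 1) → ℝ) :=
      (MixProd.modelDist_le_one hθ.1 (hmodel X)).trans_lt hε1
    have := hP.isProbabilityMeasure_sampleLaw (N := N) hθ.1.1
    simp [hclose, hδ.le]
  · exact MixProd.le_sampleLaw_real_modelDist_estimator_lt hk hζ hζ1 hπ hε hε1 hδ hδ2
      (MixProd.le_mul_sq_of_mem_separatedModels le_rfl hk hζ hζ1 hπ hε hδ hδ2 hN hθ) hθ hP
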